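/- Let $\mathbb R^+=(0,\infty)$, let $n\ge 2$, let $I\subset\mathbb R$ be a measurable set, and let $A$ be any set of ordered pairs $\alpha=(i_\alpha,i'_\alpha)$ with $1\le i_\alpha,i'_\alpha\le n$. Let $k_1,\dots,k_n$ be measurable and bounded complex-valued functions on $I\times\mathbb R^+$, and suppose that for each $i$ there is a constant $C_i<\infty$ with $$\Big\|\int_{\mathbb R^+}k_i(\cdot,x)f(x)\,dx\Big\|_{L^2(I,d\lambda)}\le C_i\|f\|_{L^2(\mathbb R^+,dx)}$$ for all bounded measurable functions $f$ of compact support. For finite $D_1,\dots,D_n$ put $$T_n^{D_1,\dots,D_n}(f_1,\dots,f_n)(\lambda)=\int_{(\mathbb R^+)^n}\prod_{j=1}^n f_j(x_j)\,k_j(\lambda,x_j)\,\chi_{\mathbb R^+}(D_j-x_j)\ \prod_{\alpha\in A}\chi_{\mathbb R^+}(x_{i_\alpha}-x_{i'_\alpha})\,dx_1\cdots dx_n .$$ Theorem 5.3. Let $1\le p<2$ and let $f_1,\dots,f_n\in L^p(\mathbb R^+)$ be complex-valued. Then for almost every $\lambda\in I$ the multilinear transform $T_n(f_1,\dots,f_n)$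 converges at $\lambda$: the integrals $T_n^{D_1,\dots,D_n}(f_1,\dots,f_n)(\lambda)$ converge absolutely for all finite $D_1,\dots,D_n$, and there is a number $T_n^{\infty,\dots,\infty}(f_1,\dots,f_n)(\lambda)\in\mathbb C$ such that for every $\delta>0$ there is $N_\delta$ with $$\big|T_n^{\infty,\dots,\infty}(f_1,\dots,f_n)(\lambda)-T_n^{D_1,\dots,D_n}(f_1,\dots,f_n)(\lambda)\big|<\delta\qquad\text{whenever }\min_i D_i\ge N_\delta .$$ -/

import Mathlib

open MeasureTheory Set

noncomputable section

namespace MultilinearTransform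

/-- The characteristic function of `R⁺ = (0, ∞)`, complex valued. -/
def chiPos (t : ℝ) : ℂ := (Ioi (0 : ℝ)).indicator (fun _ => (1 : ℂ)) t

/-- The integral operator `(K f)(l) = ∫_{R⁺} k(l, x) f(x) dx` with kernel `k`. -/
def kernelOp (k : ℝ → ℝ → ℂ) (f : ℝ → ℂ) (l : ℝ) : ℂ :=
  ∫ x in Ioi (0 : ℝ), k l x * f x

/-- `k` is a (Lebesgue) measurable and bounded function on `I × R⁺`. -/
def IsBoundedKernel (I : Set ℝ) (k : ℝ → ℝ → ℂ) : Prop :=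
  AEStronglyMeasurable (Function.uncurry k) (volume.restrict (I ×ˢ Ioi (0 : ℝ))) ∧
    ∃ M : ℝ, ∀ l ∈ I, ∀ x ∈ Ioi (0 : ℝ), ‖k l x‖ ≤ M

/-- The operator with kernel `k` satisfies an `L²(R⁺, dx) - L²(I, dl)` estimate on the measurable
bounded functions of compact support. -/
def SatisfiesL2Bound (I : Set ℝ) (k : ℝ → ℝ → ℂ) : Prop :=
  ∃ C : NNReal, ∀ f : ℝ → ℂ, Measurable f → (∃ B : ℝ, ∀ x, ‖f x‖ ≤ B) → HasCompactSupport f →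
    eLpNorm (kernelOp k f) 2 (volume.restrict I) ≤
      C * eLpNorm f 2 (volume.restrict (Ioi (0 : ℝ)))

/-- The integrand of the multilinear transform: the product of all `f_j(x_j) k_j(l, x_j)` and of
the factors `χ_{R⁺}(x_a - x_b)` for the pairs `(a, b)` in `A`. -/
def integrand {n : ℕ} (A : Finset (Fin n × Fin n)) (k : Fin n → ℝ → ℝ → ℂ)
    (f : Fin n → ℝ → ℂ) (l : ℝ) (x : Fin n → ℝ) : ℂ :=
  (∏ j, f j (x j) * k j l (x j)) * ∏ a ∈ A, chiPos (x a.1 - x a.2)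

/-- The domain of integration `(R⁺)ⁿ`. -/
def orthant (n : ℕ) : Set (Fin n → ℝ) := Set.univ.pi fun _ => Ioi (0 : ℝ)

/-- The multilinear transform `T_n(f_1, …, f_n)(l)`. -/
def transform {n : ℕ} (A : Finset (Fin n × Fin n)) (k : Fin n → ℝ → ℝ → ℂ)
    (f : Fin n → ℝ → ℂ) (l : ℝ) : ℂ :=
  ∫ x in orthant n, integrand A k f l x

/-- The truncated kernels `k_i(l, x) χ_{R⁺}(D_i - x)`. -/
def truncKernel {n : ℕ} (k : Fin n → ℝ → ℝ → ℂ) (D : Fin n → ℝ) : Fin n → ℝ → ℝ → ℂ :=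
  fun i l x => k i l x * chiPos (D i - x)

/-- Convergence of `T_n` on `f_1, …, f_n` at `l`: all truncated transforms are given by absolutely
convergent integrals, and they tend to a finite limit as `min_i D_i` tends to infinity. -/
def ConvergesAt {n : ℕ} (A : Finset (Fin n × Fin n)) (k : Fin n → ℝ → ℝ → ℂ)
    (f : Fin n → ℝ → ℂ) (l : ℝ) : Prop :=
  (∀ D : Fin n → ℝ,
    IntegrableOn (integrand A (truncKernel k D) f l) (orthant n)) ∧
  ∃ T : ℂ, ∀ δ : ℝ, 0 < δ → ∃ N : ℝ, ∀ D : Fin n → ℝ, (∀ i, N ≤ D i) →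
    ‖T - transform A (truncKernel k D) f l‖ < δ

end MultilinearTransform

end

/-!
The set where all factors `χ(x_a - x_b)` equal `1` is, up to a null set, a disjoint union of
permuted ordered simplices (`integral_prod_chiPos`). So for fixed `l` the truncated transforms are
finite sums of iterated integrals of the functions `φ_i(x) = f_i(x) k_i(l, x)`, cut off at the
`D_i` (`integral_orderedSimplex`). No absolute convergence is available as the `D_i` grow; what
replaces it is that the primitives of the `φ_i` have finite `r`-variation for some `r < 2`, so that
the iterated integrals converge in the sense of Young.

*Finite variation for almost every `l`.* A clock `G` maps `[0, ∞)` to `[0, 1)` so that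
`∑ ‖f_i‖ ^ p` has mass `O(2 ^ (-m))` on the preimage of each dyadic interval of length `2 ^ (-m)`.
Splitting `f_i` on such an interval at the height `2 ^ (-m / 4)`, the `L²` bound for the lower part
and the bounded kernel for the upper part give
`∑_J 2 ^ (a m) ‖∫_J φ_i‖² < ∞` for almost every `l`, with some `a > 0` depending on `p < 2`
(`ae_summable_dyadic`). Adding up the weights `2 ^ (a m) ∑_i ‖∫_J φ_i‖² + 4 ^ (-m)` of the dyadic
`J` contained in an interval gives a superadditive function `ω` with
`‖∫_s^t φ_i‖ ≤ K ω(s, t) ^ β` for some `β > 1 / 2` (`exists_control`, by chaining).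

*Convergence for such `l`.* By the Young-Loève estimate (`young_estimate`), iterated integrals are
bounded and Lipschitz with respect to the moduli of their arguments
(`hasModulus_iteratedIntegral`). Truncation does not increase the moduli. Two truncations beyond `N`
differ by functions of small modulus, because a bounded superadditive `ω` is small far out. Hence
the truncated transforms are a Cauchy net (`cauchySeq_integral_cutoff`).
-/

open Filter Topology

noncomputable section

namespace MultilinearTransform

/-! ### Controls -/

/-- A bounded control on `[0, ∞)`: a nonnegative superadditive interval function `ω`, with
`ω s t ≤ W` for all `0 ≤ s ≤ t`. -/
structure IsControl (ω : ℝ → ℝ → ℝ) (W : ℝ) : Prop where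
  nonneg : ∀ s t, 0 ≤ s → s ≤ t → 0 ≤ ω s t
  superadd : ∀ s u t, 0 ≤ s → s ≤ u → u ≤ t → ω s u + ω u t ≤ ω s t
  le_bound : ∀ s t, 0 ≤ s → s ≤ t → ω s t ≤ W

namespace IsControl

variable {ω : ℝ → ℝ → ℝ} {W : ℝ}

lemma self_eq_zero (h : IsControl ω W) {s : ℝ} (hs : 0 ≤ s) : ω s s = 0 := by
  have h1 := h.superadd s s s hs le_rfl le_rfl
  have h2 := h.nonneg s s hs le_rfl
  linarith

lemma mono (h : IsControl ω W) {s s' t' t : ℝ} (hs : 0 ≤ s) (h1 : s ≤ s') (h2 : s' ≤ t')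
    (h3 : t' ≤ t) : ω s' t' ≤ ω s t := by
  have e1 := h.superadd s s' t hs h1 (h2.trans h3)
  have e2 := h.superadd s' t' t (hs.trans h1) h2 h3
  have e3 := h.nonneg s s' hs h1
  have e4 := h.nonneg t' t (hs.trans (h1.trans h2)) h3
  linarith

lemma bound_nonneg (h : IsControl ω W) : 0 ≤ W :=
  (h.nonneg 0 0 le_rfl le_rfl).trans (h.le_bound 0 0 le_rfl le_rfl)

/-- Far out, a bounded control is small: past a point where `ω 0 N` is almost its supremum,
superadditivity leaves no room. -/
lemma exists_tail_lt (h : IsControl ω W) {ε : ℝ} (hε : 0 < ε) :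
    ∃ N, 0 ≤ N ∧ ∀ s t, N ≤ s → s ≤ t → ω s t < ε := by
  set S : Set ℝ := (fun t => ω 0 t) '' Ici 0
  have hne : S.Nonempty := ⟨_, 0, self_mem_Ici, rfl⟩
  have hb : BddAbove S := ⟨W, by rintro _ ⟨t, ht, rfl⟩; exact h.le_bound 0 t le_rfl ht⟩
  obtain ⟨_, ⟨N, hN, rfl⟩, hlt⟩ := exists_lt_of_lt_csSup hne (sub_lt_self (sSup S) hε)
  refine ⟨N, hN, fun s t hs hst => ?_⟩
  have hN : (0 : ℝ) ≤ N := hN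
  have e1 := h.superadd 0 N t le_rfl hN (hs.trans hst)
  have e2 := h.mono hN hs hst le_rfl
  have e3 : ω 0 t ≤ sSup S := le_csSup hb ⟨t, hN.trans (hs.trans hst), rfl⟩
  simp only at hlt
  linarith

end IsControl

/-! ### The sewing lemma and Young's estimate -/

/-- The constant of the sewing estimate with exponent `θ > 1`, the solution `C` of
`2 * C * 2 ^ (-θ) + 2 = C`. -/
def sewingConst (θ : ℝ) : ℝ := 2 / (1 - 2 * (1 / 2 : ℝ) ^ θ)

lemma two_mul_half_rpow_lt_one {θ : ℝ} (hθ : 1 < θ) : 2 * (1 / 2 : ℝ) ^ θ < 1 := by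
  have : (1 / 2 : ℝ) ^ θ < (1 / 2 : ℝ) ^ (1 : ℝ) :=
    Real.rpow_lt_rpow_of_exponent_gt (by norm_num) (by norm_num) hθ
  rw [Real.rpow_one] at this
  linarith

lemma sewingConst_pos {θ : ℝ} (hθ : 1 < θ) : 0 < sewingConst θ :=
  div_pos two_pos (by linarith [two_mul_half_rpow_lt_one hθ])

lemma sewingConst_eq {θ : ℝ} (hθ : 1 < θ) :
    2 * (sewingConst θ * (1 / 2 : ℝ) ^ θ) + 2 = sewingConst θ := by
  have := two_mul_half_rpow_lt_one hθ
  unfold sewingConst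
  have h : (1 - 2 * (1 / 2 : ℝ) ^ θ) ≠ 0 := by linarith
  field_simp
  ring

/-- The discrete sewing lemma. An interval function whose defect of additivity is at most
`K * ω ^ θ` with `θ > 1` differs from its sum over any partition by a constant times `ω ^ θ`.
The partition is split at the index where the control reaches half of its total. -/
lemma sewing_partition {ω : ℝ → ℝ → ℝ} {W θ K : ℝ} (hω : IsControl ω W) (hθ : 1 < θ)
    (hK : 0 ≤ K) {E : ℝ → ℝ → ℂ}
    (hE : ∀ s u v, 0 ≤ s → s ≤ u → u ≤ v → ‖E s v - E s u - E u v‖ ≤ K * ω s v ^ θ)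
    {t : ℕ → ℝ} (ht : Monotone t) (ht0 : 0 ≤ t 0) (n : ℕ) : ∀ m,
    ‖E (t m) (t (m + n)) - ∑ i ∈ Finset.range n, E (t (m + i)) (t (m + i + 1))‖ ≤
      sewingConst θ * K * ω (t m) (t (m + n)) ^ θ := by
  have hp : ∀ i, 0 ≤ t i := fun i => ht0.trans (ht (Nat.zero_le i))
  have hC := sewingConst_pos hθ
  induction n using Nat.strong_induction_on with
  | _ n ih =>
  intro m
  rcases Nat.eq_zero_or_pos n with rfl | hn
  · have h1 := hE (t m) (t m) (t m) (hp m) le_rfl le_rfl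
    have h0 : (0 : ℝ) ^ θ = 0 := Real.zero_rpow (by linarith)
    rw [hω.self_eq_zero (hp m), h0] at h1
    simp only [add_zero, Finset.range_zero, Finset.sum_empty, sub_zero]
    rw [hω.self_eq_zero (hp m), h0]
    simpa using h1
  set w := ω (t m) (t (m + n)) with hw
  have hw0 : 0 ≤ w := hω.nonneg _ _ (hp m) (ht (by omega))
  obtain ⟨k, hkn, hk1, hk2⟩ : ∃ k, k < n ∧ ω (t m) (t (m + k)) ≤ w / 2 ∧
      ω (t (m + (k + 1))) (t (m + n)) ≤ w / 2 := by
    classical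
    let P : ℕ → Prop := fun k => ω (t m) (t (m + k)) ≤ w / 2
    have hP0 : P 0 := by
      change ω (t m) (t (m + 0)) ≤ w / 2
      rw [add_zero, hω.self_eq_zero (hp m)]; positivity
    have hle : Nat.findGreatest P (n - 1) ≤ n - 1 := Nat.findGreatest_le _
    refine ⟨Nat.findGreatest P (n - 1), by omega,
      Nat.findGreatest_spec (P := P) (Nat.zero_le _) hP0, ?_⟩
    set k := Nat.findGreatest P (n - 1) with hk
    rcases hle.lt_or_eq with hlt | heq
    · have hnP : ¬ P (k + 1) := Nat.findGreatest_is_greatest (n := n - 1) (by omega) (by omega)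
      have hnP' : w / 2 < ω (t m) (t (m + (k + 1))) := not_le.1 hnP
      have := hω.superadd (t m) (t (m + (k + 1))) (t (m + n)) (hp m) (ht (by omega))
        (ht (by omega))
      linarith
    · rw [show m + (k + 1) = m + n by omega, hω.self_eq_zero (hp _)]; positivity
  have i1 := ih k hkn m
  have i2 := ih (n - k - 1) (by omega) (m + (k + 1))
  rw [show m + (k + 1) + (n - k - 1) = m + n by omega] at i2
  have d1 := hE (t m) (t (m + k)) (t (m + n)) (hp m) (ht (by omega)) (ht (by omega))
  have d2 := hE (t (m + k)) (t (m + (k + 1))) (t (m + n)) (hp _) (ht (by omega)) (ht (by omega))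
  have hsplit : ∑ i ∈ Finset.range n, E (t (m + i)) (t (m + i + 1)) =
      ∑ i ∈ Finset.range k, E (t (m + i)) (t (m + i + 1)) + E (t (m + k)) (t (m + (k + 1))) +
      ∑ i ∈ Finset.range (n - k - 1), E (t (m + (k + 1) + i)) (t (m + (k + 1) + i + 1)) := by
    conv_lhs => rw [show n = (k + 1) + (n - k - 1) by omega]
    rw [Finset.sum_range_add, Finset.sum_range_succ]
    simp only [add_assoc]
  have p1 : ω (t m) (t (m + k)) ^ θ ≤ (1 / 2 : ℝ) ^ θ * w ^ θ := by
    rw [← Real.mul_rpow (by norm_num) hw0]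
    exact Real.rpow_le_rpow (hω.nonneg _ _ (hp _) (ht (by omega))) (by linarith) (by linarith)
  have p2 : ω (t (m + (k + 1))) (t (m + n)) ^ θ ≤ (1 / 2 : ℝ) ^ θ * w ^ θ := by
    rw [← Real.mul_rpow (by norm_num) hw0]
    exact Real.rpow_le_rpow (hω.nonneg _ _ (hp _) (ht (by omega))) (by linarith) (by linarith)
  have p3 : ω (t (m + k)) (t (m + n)) ^ θ ≤ w ^ θ :=
    Real.rpow_le_rpow (hω.nonneg _ _ (hp _) (ht (by omega)))
      (hω.mono (hp m) (ht (by omega)) (ht (by omega)) le_rfl) (by linarith)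
  rw [hsplit]
  calc _ = ‖(E (t m) (t (m + n)) - E (t m) (t (m + k)) - E (t (m + k)) (t (m + n))) +
        (E (t (m + k)) (t (m + n)) - E (t (m + k)) (t (m + (k + 1))) -
          E (t (m + (k + 1))) (t (m + n))) +
        (E (t m) (t (m + k)) - ∑ i ∈ Finset.range k, E (t (m + i)) (t (m + i + 1))) +
        (E (t (m + (k + 1))) (t (m + n)) - ∑ i ∈ Finset.range (n - k - 1),
          E (t (m + (k + 1) + i)) (t (m + (k + 1) + i + 1)))‖ := by congr 1; ring
    _ ≤ K * w ^ θ + K * w ^ θ + sewingConst θ * K * ((1 / 2 : ℝ) ^ θ * w ^ θ) +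
        sewingConst θ * K * ((1 / 2 : ℝ) ^ θ * w ^ θ) := by
      refine (norm_add_le _ _).trans (add_le_add ((norm_add_le _ _).trans (add_le_add
        ((norm_add_le _ _).trans (add_le_add d1 (d2.trans ?_))) (i1.trans ?_))) (i2.trans ?_))
      all_goals gcongr
    _ = (2 * (sewingConst θ * (1 / 2 : ℝ) ^ θ) + 2) * K * w ^ θ := by ring
    _ = _ := by rw [sewingConst_eq hθ]

/-- The Young-Loève estimate for integrals of a continuous function against an absolutely
continuous one. Only the moduli of both with respect to a control enter the bound, and not the
`L¹` norm of `ψ`. -/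
lemma young_estimate {ω : ℝ → ℝ → ℝ} {W β a b : ℝ} (hω : IsControl ω W) (hβ : 1 / 2 < β)
    (ha : 0 ≤ a) (hb : 0 ≤ b) {Y ψ : ℝ → ℂ} (hY : Continuous Y) (hψ : Integrable ψ)
    (hYω : ∀ s t, 0 ≤ s → s ≤ t → ‖Y t - Y s‖ ≤ a * ω s t ^ β)
    (hψω : ∀ s t, 0 ≤ s → s ≤ t → ‖∫ x in s..t, ψ x‖ ≤ b * ω s t ^ β)
    {s t : ℝ} (hs : 0 ≤ s) (hst : s ≤ t) :
    ‖∫ x in s..t, (Y x - Y s) * ψ x‖ ≤ sewingConst (2 * β) * (a * b) * ω s t ^ (2 * β) := by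
  have hint : ∀ (c : ℂ) (u v : ℝ), IntervalIntegrable (fun x => (Y x - c) * ψ x) volume u v :=
    fun c u v => (hψ.intervalIntegrable).continuousOn_mul (hY.sub continuous_const).continuousOn
  set E : ℝ → ℝ → ℂ := fun s t => ∫ x in s..t, (Y x - Y s) * ψ x with hE
  have hdef : ∀ s u v, 0 ≤ s → s ≤ u → u ≤ v →
      ‖E s v - E s u - E u v‖ ≤ a * b * ω s v ^ (2 * β) := by
    intro s u v hs hsu huv
    have e1 : E s v - E s u - E u v = (Y u - Y s) * ∫ x in u..v, ψ x := by
      simp only [hE]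
      rw [intervalIntegral.integral_interval_sub_left (hint _ _ _) (hint _ _ _),
        ← intervalIntegral.integral_sub (hint _ _ _) (hint _ _ _),
        ← intervalIntegral.integral_const_mul]
      congr 1; ext x; ring
    rw [e1, norm_mul]
    have h0 := hω.nonneg s v hs (hsu.trans huv)
    have h1 : ω s u ^ β ≤ ω s v ^ β := Real.rpow_le_rpow (hω.nonneg _ _ hs hsu)
      (hω.mono hs le_rfl hsu huv) (by linarith)
    have h2 : ω u v ^ β ≤ ω s v ^ β := Real.rpow_le_rpow (hω.nonneg _ _ (hs.trans hsu) huv)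
      (hω.mono hs hsu huv le_rfl) (by linarith)
    have h3 : ω s v ^ (2 * β) = ω s v ^ β * ω s v ^ β := by
      rw [two_mul, Real.rpow_add_of_nonneg h0 (by linarith) (by linarith)]
    rw [h3, show a * b * (ω s v ^ β * ω s v ^ β) = (a * ω s v ^ β) * (b * ω s v ^ β) by ring]
    gcongr
    · exact (hYω s u hs hsu).trans (by gcongr)
    · exact (hψω u v (hs.trans hsu) huv).trans (by gcongr)
  refine le_of_forall_pos_le_add fun ε hε => ?_
  -- a partition so fine that `Y` oscillates by less than `η` on each of its intervals
  set A : ℝ := ∫ x in s..t, ‖ψ x‖ with hA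
  have hA0 : 0 ≤ A := intervalIntegral.integral_nonneg hst fun _ _ => norm_nonneg _
  set η : ℝ := ε / (A + 1)
  have hη : 0 < η := by positivity
  obtain ⟨δ, hδ, hYδ⟩ := Metric.uniformContinuousOn_iff.1
    (isCompact_Icc.uniformContinuousOn_of_continuous (hY.continuousOn (s := Icc s t))) η hη
  obtain ⟨N, hN⟩ := exists_nat_gt ((t - s) / δ)
  have hN0 : (0 : ℝ) < N := (div_nonneg (sub_nonneg.2 hst) hδ.le).trans_lt hN
  set τ : ℕ → ℝ := fun i => s + i * ((t - s) / N) with hτ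
  have hd0 : 0 ≤ (t - s) / N := div_nonneg (sub_nonneg.2 hst) hN0.le
  have hdδ : (t - s) / N < δ := by
    rw [div_lt_iff₀ hδ] at hN
    rw [div_lt_iff₀ hN0]; linarith
  have hmono : Monotone τ := fun i j hij => by
    simp only [hτ]; gcongr
  have hτ0 : τ 0 = s := by simp [hτ]
  have hτN : τ N = t := by simp only [hτ]; field_simp; ring
  have key := sewing_partition hω (θ := 2 * β) (by linarith) (mul_nonneg ha hb) hdef hmono
    (by rw [hτ0]; exact hs) N 0
  simp only [zero_add, hτ0, hτN] at key
  have hsmall : ‖∑ i ∈ Finset.range N, E (τ i) (τ (i + 1))‖ ≤ ε := by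
    calc _ ≤ ∑ i ∈ Finset.range N, η * ∫ x in (τ i)..(τ (i + 1)), ‖ψ x‖ := by
          refine norm_sum_le_of_le _ fun i hi => ?_
          have hle : τ i ≤ τ (i + 1) := hmono (Nat.le_succ i)
          rw [← intervalIntegral.integral_const_mul]
          refine intervalIntegral.norm_integral_le_of_norm_le hle ?_
            (hψ.norm.intervalIntegrable.const_mul η)
          filter_upwards with x hx
          rw [norm_mul]
          gcongr
          have hs1 : s ≤ τ i := hτ0 ▸ hmono (Nat.zero_le i)
          have ht1 : τ (i + 1) ≤ t := hτN ▸ hmono (Finset.mem_range.1 hi)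
          have hstep : τ (i + 1) = τ i + (t - s) / N := by simp only [hτ]; push_cast; ring
          rw [← dist_eq_norm]
          refine (hYδ x ⟨hs1.trans hx.1.le, hx.2.trans ht1⟩ (τ i) ⟨hs1, hle.trans ht1⟩ ?_).le
          rw [Real.dist_eq, abs_of_pos (sub_pos.2 hx.1)]
          linarith [hx.2]
      _ = η * A := by
          rw [← Finset.mul_sum, intervalIntegral.sum_integral_adjacent_intervals
            fun _ _ => hψ.norm.intervalIntegrable, hτ0, hτN]
      _ ≤ ε := by
          rw [div_mul_eq_mul_div, div_le_iff₀ (by positivity)]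
          nlinarith
  calc ‖E s t‖ = ‖(E s t - ∑ i ∈ Finset.range N, E (τ i) (τ (i + 1))) +
        ∑ i ∈ Finset.range N, E (τ i) (τ (i + 1))‖ := by rw [sub_add_cancel]
    _ ≤ _ := (norm_add_le _ _).trans (add_le_add key hsmall)

/-- `Y` is bounded by `a` and has modulus `a * ω ^ β` on `[0, ∞)`. -/
def HasModulus (ω : ℝ → ℝ → ℝ) (β a : ℝ) (Y : ℝ → ℂ) : Prop :=
  (∀ t, 0 ≤ t → ‖Y t‖ ≤ a) ∧ ∀ s t, 0 ≤ s → s ≤ t → ‖Y t - Y s‖ ≤ a * ω s t ^ β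

/-- The constant in the continuity of `(Y, ψ) ↦ ∫ Y ψ` with respect to the moduli of `Y` and of
the primitive of `ψ`. -/
def youngConst (W β : ℝ) : ℝ := (1 + sewingConst (2 * β) * W ^ β) * (1 + W ^ β)

lemma youngConst_nonneg {W β : ℝ} (hW : 0 ≤ W) (hβ : 1 / 2 < β) : 0 ≤ youngConst W β := by
  have := (sewingConst_pos (θ := 2 * β) (by linarith)).le
  unfold youngConst; positivity

lemma HasModulus.primitive {ω : ℝ → ℝ → ℝ} {W β a b : ℝ} (hω : IsControl ω W) (hβ : 1 / 2 < β)
    (ha : 0 ≤ a) (hb : 0 ≤ b) {Y ψ : ℝ → ℂ} (hY : Continuous Y) (hψ : Integrable ψ)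
    (hYω : HasModulus ω β a Y)
    (hψω : ∀ s t, 0 ≤ s → s ≤ t → ‖∫ x in s..t, ψ x‖ ≤ b * ω s t ^ β) :
    HasModulus ω β (youngConst W β * (a * b)) fun t => ∫ x in (0 : ℝ)..t, Y x * ψ x := by
  have hC := (sewingConst_pos (θ := 2 * β) (by linarith)).le
  have hW := hω.bound_nonneg
  have hint : ∀ (u v : ℝ), IntervalIntegrable (fun x => Y x * ψ x) volume u v :=
    fun u v => (hψ.intervalIntegrable).continuousOn_mul hY.continuousOn
  have hinc : ∀ s t, 0 ≤ s → s ≤ t → ‖∫ x in s..t, Y x * ψ x‖ ≤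
      (1 + sewingConst (2 * β) * W ^ β) * (a * b) * ω s t ^ β := by
    intro s t hs hst
    have h0 := hω.nonneg s t hs hst
    have e1 : ∫ x in s..t, Y x * ψ x =
        Y s * (∫ x in s..t, ψ x) + ∫ x in s..t, (Y x - Y s) * ψ x := by
      have hi : IntervalIntegrable (fun x => (Y x - Y s) * ψ x) volume s t :=
        (hψ.intervalIntegrable).continuousOn_mul (hY.sub continuous_const).continuousOn
      rw [← intervalIntegral.integral_const_mul, ← intervalIntegral.integral_add
        (hψ.intervalIntegrable.const_mul _) hi]
      congr 1; ext x; ring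
    have hy := young_estimate hω hβ ha hb hY hψ hYω.2 hψω hs hst
    have h3 : ω s t ^ (2 * β) ≤ W ^ β * ω s t ^ β := by
      rw [two_mul, Real.rpow_add_of_nonneg h0 (by linarith) (by linarith)]
      exact mul_le_mul_of_nonneg_right (Real.rpow_le_rpow h0 (hω.le_bound s t hs hst)
        (by linarith)) (Real.rpow_nonneg h0 _)
    rw [e1]
    calc _ ≤ a * (b * ω s t ^ β) + sewingConst (2 * β) * (a * b) * (W ^ β * ω s t ^ β) := by
          refine (norm_add_le _ _).trans (add_le_add ?_ (hy.trans (by gcongr)))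
          rw [norm_mul]
          exact mul_le_mul (hYω.1 s hs) (hψω s t hs hst) (norm_nonneg _) ha
      _ = _ := by ring
  have hWβ : 0 ≤ W ^ β := Real.rpow_nonneg hW β
  have hab : 0 ≤ (1 + sewingConst (2 * β) * W ^ β) * (a * b) := by positivity
  refine ⟨fun t ht => (hinc 0 t le_rfl ht).trans ?_, fun s t hs hst => ?_⟩
  · have h1 : ω 0 t ^ β ≤ W ^ β := Real.rpow_le_rpow (hω.nonneg _ _ le_rfl ht)
      (hω.le_bound _ _ le_rfl ht) (by linarith)
    have h2 : youngConst W β * (a * b) =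
        (1 + sewingConst (2 * β) * W ^ β) * (a * b) * (1 + W ^ β) := by
      unfold youngConst; ring
    rw [h2]
    gcongr
    linarith
  · rw [intervalIntegral.integral_interval_sub_left (hint _ _) (hint _ _)]
    refine (hinc s t hs hst).trans ?_
    have h0 : 0 ≤ ω s t ^ β := Real.rpow_nonneg (hω.nonneg s t hs hst) β
    have h2 : youngConst W β * (a * b) =
        (1 + sewingConst (2 * β) * W ^ β) * (a * b) * (1 + W ^ β) := by
      unfold youngConst; ring
    rw [h2]
    exact mul_le_mul_of_nonneg_right (le_mul_of_one_le_right hab (by linarith)) h0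

/-! ### Iterated integrals -/

/-- The iterated integrals `∫_{0 < x_0 < ⋯ < x_{n-1} < t} ∏ ψ_i(x_i) dx`, as a function of `t`. -/
def iteratedIntegral : (n : ℕ) → (Fin n → ℝ → ℂ) → ℝ → ℂ
  | 0, _, _ => 1
  | n + 1, ψ, t =>
    ∫ x in (0 : ℝ)..t, iteratedIntegral n (fun i => ψ i.castSucc) x * ψ (Fin.last n) x

lemma continuous_iteratedIntegral (n : ℕ) : ∀ {ψ : Fin n → ℝ → ℂ}, (∀ i, Integrable (ψ i)) →
    Continuous (iteratedIntegral n ψ) := by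
  induction n with
  | zero => intro ψ _; exact continuous_const
  | succ n ih =>
    intro ψ hψ
    exact intervalIntegral.continuous_primitive (fun a b =>
      (hψ _).intervalIntegrable.continuousOn_mul (ih fun i => hψ i.castSucc).continuousOn) 0

/-- Iterated integrals are bounded, and Lipschitz in their arguments, with constants which depend
on the moduli of the primitives only. -/
lemma hasModulus_iteratedIntegral {ω : ℝ → ℝ → ℝ} {W β b : ℝ} (hω : IsControl ω W)
    (hβ : 1 / 2 < β) (hb : 0 ≤ b) (n : ℕ) : ∃ C, 0 ≤ C ∧ ∀ (ψ ψ' : Fin n → ℝ → ℂ) (ε : ℝ), 0 ≤ ε →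
    (∀ i, Integrable (ψ i)) → (∀ i, Integrable (ψ' i)) →
    (∀ i s t, 0 ≤ s → s ≤ t → ‖∫ x in s..t, ψ i x‖ ≤ b * ω s t ^ β) →
    (∀ i s t, 0 ≤ s → s ≤ t → ‖∫ x in s..t, ψ' i x‖ ≤ b * ω s t ^ β) →
    (∀ i s t, 0 ≤ s → s ≤ t → ‖∫ x in s..t, (ψ i x - ψ' i x)‖ ≤ ε * ω s t ^ β) →
    HasModulus ω β C (iteratedIntegral n ψ) ∧
    HasModulus ω β (C * ε) fun t => iteratedIntegral n ψ t - iteratedIntegral n ψ' t := by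
  have hY0 := youngConst_nonneg hω.bound_nonneg hβ
  induction n with
  | zero =>
    refine ⟨1, zero_le_one, fun ψ ψ' ε hε _ _ _ _ _ => ⟨⟨fun t _ => ?_, fun s t hs hst => ?_⟩,
      ⟨fun t _ => ?_, fun s t hs hst => ?_⟩⟩⟩
    all_goals simp only [iteratedIntegral, sub_self, norm_zero, norm_one, le_refl]
    · have := Real.rpow_nonneg (hω.nonneg s t hs hst) β; positivity
    · positivity
    · have := Real.rpow_nonneg (hω.nonneg s t hs hst) β; positivity
  | succ n ih =>
    obtain ⟨C, hC, h⟩ := ih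
    refine ⟨youngConst W β * (C * b) + youngConst W β * C, by positivity,
      fun ψ ψ' ε hε hψ hψ' hb1 hb2 hd => ?_⟩
    obtain ⟨h1, h2⟩ := h (fun i => ψ i.castSucc) (fun i => ψ' i.castSucc) ε hε
      (fun i => hψ _) (fun i => hψ' _) (fun i => hb1 _) (fun i => hb2 _) (fun i => hd _)
    obtain ⟨h1', -⟩ := h (fun i => ψ' i.castSucc) (fun i => ψ' i.castSucc) 0 le_rfl
      (fun i => hψ' _) (fun i => hψ' _) (fun i => hb2 _) (fun i => hb2 _) (fun i s t _ _ => by simp)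
    have c1 := continuous_iteratedIntegral n (ψ := fun i => ψ i.castSucc) fun i => hψ _
    have c2 := continuous_iteratedIntegral n (ψ := fun i => ψ' i.castSucc) fun i => hψ' _
    have weaken : ∀ {a a' : ℝ} {Y : ℝ → ℂ}, a ≤ a' → HasModulus ω β a Y → HasModulus ω β a' Y := by
      intro a a' Y haa hY
      refine ⟨fun t ht => (hY.1 t ht).trans haa, fun s t hs hst => (hY.2 s t hs hst).trans ?_⟩
      have := Real.rpow_nonneg (hω.nonneg s t hs hst) β
      gcongr
    refine ⟨weaken (by nlinarith [mul_nonneg hY0 hC])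
      (HasModulus.primitive hω hβ hC hb c1 (hψ (Fin.last n)) h1 (hb1 _)), ?_⟩
    have m1 := HasModulus.primitive hω hβ (mul_nonneg hC hε) hb (c1.sub c2) (hψ (Fin.last n)) h2
      (hb1 _)
    have m2 := HasModulus.primitive hω hβ hC hε c2 ((hψ (Fin.last n)).sub (hψ' (Fin.last n))) h1'
      (hd _)
    have hfun : (fun t => iteratedIntegral (n + 1) ψ t - iteratedIntegral (n + 1) ψ' t) =
        fun t => (∫ x in (0 : ℝ)..t, (iteratedIntegral n (fun i => ψ i.castSucc) x -
            iteratedIntegral n (fun i => ψ' i.castSucc) x) * ψ (Fin.last n) x) +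
          ∫ x in (0 : ℝ)..t, iteratedIntegral n (fun i => ψ' i.castSucc) x *
            (ψ (Fin.last n) x - ψ' (Fin.last n) x) := by
      ext t
      simp only [iteratedIntegral]
      have hi1 : IntervalIntegrable (fun x => (iteratedIntegral n (fun i => ψ i.castSucc) x -
          iteratedIntegral n (fun i => ψ' i.castSucc) x) * ψ (Fin.last n) x) volume 0 t :=
        (hψ _).intervalIntegrable.continuousOn_mul (c1.sub c2).continuousOn
      have hi2 : IntervalIntegrable (fun x => iteratedIntegral n (fun i => ψ' i.castSucc) x *
          (ψ (Fin.last n) x - ψ' (Fin.last n) x)) volume 0 t :=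
        ((hψ _).sub (hψ' _)).intervalIntegrable.continuousOn_mul c2.continuousOn
      rw [← intervalIntegral.integral_sub
          ((hψ _).intervalIntegrable.continuousOn_mul c1.continuousOn)
          ((hψ' _).intervalIntegrable.continuousOn_mul c2.continuousOn),
        ← intervalIntegral.integral_add hi1 hi2]
      congr 1; ext x; ring
    rw [hfun]
    refine ⟨fun t ht => ?_, fun s t hs hst => ?_⟩
    · refine (norm_add_le _ _).trans ((add_le_add (m1.1 t ht) (m2.1 t ht)).trans (le_of_eq ?_))
      ring
    · rw [add_sub_add_comm]
      refine (norm_add_le _ _).trans ((add_le_add (m1.2 s t hs hst) (m2.2 s t hs hst)).trans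
        (le_of_eq ?_))
      ring

/-! ### Clocks and dyadic chaining -/

/-- A clock on `[0, ∞)`: a strictly increasing bijection `G` from `[0, ∞)` to `[0, 1)`, together
with its inverse `H`. -/
structure IsClock (G H : ℝ → ℝ) : Prop where
  strictMonoOn : StrictMonoOn G (Ici 0)
  nonneg : ∀ t, 0 ≤ t → 0 ≤ G t
  lt_one : ∀ t, 0 ≤ t → G t < 1
  inv_nonneg : ∀ y, 0 ≤ y → y < 1 → 0 ≤ H y
  apply_inv : ∀ y, 0 ≤ y → y < 1 → G (H y) = y

/-- The normalized distribution function of a positive integrable density is a clock. -/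
lemma exists_clock {F : ℝ → ℝ} (hF : ∀ x, 0 < x → 0 ≤ F x) (hFi : IntegrableOn F (Ioi 0)) :
    ∃ (G H : ℝ → ℝ) (L : ℝ), IsClock G H ∧ 0 ≤ L ∧
      ∀ s t, 0 ≤ s → s ≤ t → ∫ x in Ioc s t, F x ≤ L * (G t - G s) := by
  -- the term `exp (-x)` makes the density strictly positive
  set P : ℝ → ℝ := fun x => F x + Real.exp (-x) with hP
  have hei : IntegrableOn (fun x : ℝ => Real.exp (-x)) (Ioi 0) := integrableOn_exp_neg_Ioi 0
  have hPi : IntegrableOn P (Ioi 0) := hFi.add hei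
  have hPpos : ∀ x, 0 < x → 0 < P x := fun x hx => add_pos_of_nonneg_of_pos (hF x hx)
    (Real.exp_pos _)
  have hII : ∀ s t, 0 ≤ s → s ≤ t → IntervalIntegrable P volume s t := fun s t hs hst =>
    (intervalIntegrable_iff_integrableOn_Ioc_of_le hst).2
      (hPi.mono_set fun x hx => hs.trans_lt hx.1)
  have hpos : ∀ s t, 0 ≤ s → s < t → 0 < ∫ x in s..t, P x := fun s t hs hst =>
    intervalIntegral.intervalIntegral_pos_of_pos_on (hII s t hs hst.le)
      (fun x hx => hPpos x (hs.trans_lt hx.1)) hst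
  set L : ℝ := ∫ x in Ioi 0, P x with hL
  set g : ℝ → ℝ := fun t => ∫ x in (0 : ℝ)..t, P x with hg
  have hgle : ∀ t, 0 ≤ t → g t ≤ L := by
    intro t ht
    simp only [hg, intervalIntegral.integral_of_le ht]
    refine setIntegral_mono_set hPi ?_ (LE.le.eventuallyLE fun x hx => hx.1)
    filter_upwards [ae_restrict_mem measurableSet_Ioi] with x hx using (hPpos x hx).le
  have hsub : ∀ s t, 0 ≤ s → s ≤ t → g t - g s = ∫ x in s..t, P x := fun s t hs hst =>
    intervalIntegral.integral_interval_sub_left (hII 0 t le_rfl (hs.trans hst)) (hII 0 s le_rfl hs)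
  have hmono : ∀ s t, 0 ≤ s → s < t → g s < g t := fun s t hs hst => by
    have := hpos s t hs hst
    rw [← hsub s t hs hst.le] at this
    linarith
  have hL0 : 0 < L := by
    have h0 : g 0 = 0 := by simp [hg]
    linarith [hmono 0 1 le_rfl one_pos, hgle 1 zero_le_one]
  have hcont : ∀ t, 0 ≤ t → ContinuousOn g (Icc 0 t) := fun t ht => by
    have := intervalIntegral.continuousOn_primitive_interval (a := (0 : ℝ)) (b := t) (μ := volume)
      (f := P) (by
        rw [uIcc_of_le ht, integrableOn_Icc_iff_integrableOn_Ioc]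
        exact hPi.mono_set fun x hx => hx.1)
    rwa [uIcc_of_le ht] at this
  have hlim : Tendsto g atTop (𝓝 L) := intervalIntegral_tendsto_integral_Ioi 0 hPi tendsto_id
  have hsurj : ∀ y, 0 ≤ y → y < 1 → ∃ t, 0 ≤ t ∧ g t / L = y := by
    intro y hy hy1
    have hyL : y * L < L := by nlinarith
    obtain ⟨t, ht0, ht⟩ := ((eventually_ge_atTop (0 : ℝ)).and (hlim.eventually_const_lt hyL)).exists
    have h0 : g 0 = 0 := by simp [hg]
    obtain ⟨x, hx, hxy⟩ := intermediate_value_Icc ht0 (hcont t ht0)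
      (show y * L ∈ Icc (g 0) (g t) from ⟨by rw [h0]; positivity, ht.le⟩)
    exact ⟨x, hx.1, by rw [hxy]; field_simp⟩
  choose! H hH0 hH using hsurj
  refine ⟨fun t => g t / L, H, L, ⟨fun s hs t _ hst => ?_, fun t ht => ?_, fun t ht => ?_, hH0, hH⟩,
    hL0.le, fun s t hs hst => ?_⟩
  · exact div_lt_div_of_pos_right (hmono s t hs hst) hL0
  · refine div_nonneg ?_ hL0.le
    rcases ht.eq_or_lt with rfl | h
    · simp [hg]
    · exact (hpos 0 t le_rfl h).le
  · rw [div_lt_one hL0]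
    exact (hmono t (t + 1) ht (by linarith)).trans_le (hgle _ (by linarith))
  · have hsub' : Ioc s t ⊆ Ioi 0 := fun x hx => hs.trans_lt hx.1
    rw [← sub_div, mul_div_cancel₀ _ hL0.ne', hsub s t hs hst, intervalIntegral.integral_of_le hst]
    refine setIntegral_mono_on (hFi.mono_set hsub') (hPi.mono_set hsub') measurableSet_Ioc ?_
    intro x _
    simp only [hP]
    linarith [Real.exp_pos (-x)]

/-- Chaining over dyadic points. Two points of level `M + 1` are joined through their neighbours
of level `M`, and in level `0` there is only one point below `1`. -/
lemma dyadic_chaining {Ψ : ℝ → ℂ} {u v B ρ : ℝ} (hv : v < 1) (hB : 0 ≤ B)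
    (hρ0 : 0 ≤ ρ)
    (h : ∀ m i : ℕ, u ≤ i / 2 ^ m → ((i : ℝ) + 1) / 2 ^ m ≤ v →
      ‖Ψ (((i : ℝ) + 1) / 2 ^ m) - Ψ (i / 2 ^ m)‖ ≤ B * ρ ^ m) (M : ℕ) :
    ∀ i j : ℕ, i ≤ j → u ≤ i / 2 ^ M → (j : ℝ) / 2 ^ M ≤ v →
      ‖Ψ (j / 2 ^ M) - Ψ (i / 2 ^ M)‖ ≤ 2 * B * ∑ m ∈ Finset.range (M + 1), ρ ^ m := by
  induction M with
  | zero =>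
    intro i j hij hi hj
    have hj1 : (j : ℝ) < 1 := by
      have : (j : ℝ) ≤ v := by simpa using hj
      linarith
    have : j = 0 := by
      have : j < 1 := by exact_mod_cast hj1
      omega
    subst this
    obtain rfl : i = 0 := by omega
    simp only [sub_self, norm_zero]
    positivity
  | succ M ih =>
    intro i j hij hi hj
    have hpow : 0 ≤ B * ρ ^ (M + 1) := by positivity
    have hsum0 : 0 ≤ 2 * B * ∑ m ∈ Finset.range (M + 1), ρ ^ m := by
      have : 0 ≤ ∑ m ∈ Finset.range (M + 1), ρ ^ m := Finset.sum_nonneg fun _ _ => by positivity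
      positivity
    rw [Finset.sum_range_succ, mul_add]
    rcases hij.eq_or_lt with rfl | hlt
    · simp only [sub_self, norm_zero]
      linarith
    have hdouble : ∀ k : ℕ, (k : ℝ) / 2 ^ M = ((2 * k : ℕ) : ℝ) / 2 ^ (M + 1) := by
      intro k
      push_cast
      rw [pow_succ']
      field_simp
    have hle : ∀ a b : ℕ, a ≤ b → (a : ℝ) / 2 ^ (M + 1) ≤ (b : ℝ) / 2 ^ (M + 1) := fun a b hab => by
      gcongr
    obtain ⟨i', hi', hi1⟩ : ∃ i', (2 * i' = i ∨ 2 * i' = i + 1) ∧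
        ‖Ψ (((2 * i' : ℕ) : ℝ) / 2 ^ (M + 1)) - Ψ (i / 2 ^ (M + 1))‖ ≤ B * ρ ^ (M + 1) := by
      rcases Nat.even_or_odd' i with ⟨k, rfl | rfl⟩
      · exact ⟨k, Or.inl rfl, by simpa using hpow⟩
      · refine ⟨k + 1, Or.inr (by ring), ?_⟩
        have := h (M + 1) (2 * k + 1) hi ((by
          have := hle (2 * k + 1 + 1) j (by omega)
          push_cast at this ⊢
          exact this.trans hj))
        convert this using 5
        push_cast; ring
    obtain ⟨j', hj', hj1⟩ : ∃ j', (2 * j' = j ∨ 2 * j' + 1 = j) ∧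
        ‖Ψ (j / 2 ^ (M + 1)) - Ψ (((2 * j' : ℕ) : ℝ) / 2 ^ (M + 1))‖ ≤ B * ρ ^ (M + 1) := by
      rcases Nat.even_or_odd' j with ⟨k, rfl | rfl⟩
      · exact ⟨k, Or.inl rfl, by simpa using hpow⟩
      · refine ⟨k, Or.inr rfl, ?_⟩
        have := h (M + 1) (2 * k) (hi.trans (hle _ _ (by omega))) (by
          push_cast at hj ⊢
          exact hj)
        convert this using 5
        push_cast; ring
    have hmid := ih i' j' (by omega) (by rw [hdouble]; exact hi.trans (hle _ _ (by omega)))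
      (by rw [hdouble]; exact (hle _ _ (by omega)).trans hj)
    rw [hdouble, hdouble] at hmid
    calc _ = ‖(Ψ (j / 2 ^ (M + 1)) - Ψ (((2 * j' : ℕ) : ℝ) / 2 ^ (M + 1))) +
          (Ψ (((2 * j' : ℕ) : ℝ) / 2 ^ (M + 1)) - Ψ (((2 * i' : ℕ) : ℝ) / 2 ^ (M + 1))) +
          (Ψ (((2 * i' : ℕ) : ℝ) / 2 ^ (M + 1)) - Ψ (i / 2 ^ (M + 1)))‖ := by congr 1; ring
      _ ≤ B * ρ ^ (M + 1) + 2 * B * ∑ m ∈ Finset.range (M + 1), ρ ^ m + B * ρ ^ (M + 1) :=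
          (norm_add_le _ _).trans (add_le_add ((norm_add_le _ _).trans (add_le_add hj1 hmid)) hi1)
      _ = _ := by ring

namespace IsClock

variable {G H : ℝ → ℝ}

lemma le_iff (h : IsClock G H) {s t : ℝ} (hs : 0 ≤ s) (ht : 0 ≤ t) : G s ≤ G t ↔ s ≤ t :=
  h.strictMonoOn.le_iff_le hs ht

lemma inv_le_inv (h : IsClock G H) {y z : ℝ} (hy : 0 ≤ y) (hyz : y ≤ z) (hz : z < 1) :
    H y ≤ H z := by
  have hy1 := hyz.trans_lt hz
  have hz0 := hy.trans hyz
  rwa [← h.le_iff (h.inv_nonneg y hy hy1) (h.inv_nonneg z hz0 hz), h.apply_inv y hy hy1,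
    h.apply_inv z hz0 hz]

lemma tendsto_inv_floor (h : IsClock G H) {t : ℝ} (ht : 0 ≤ t) :
    Tendsto (fun M : ℕ => H ((⌊G t * 2 ^ M⌋₊ : ℝ) / 2 ^ M)) atTop (𝓝 t) := by
  have hG := h.nonneg t ht
  have hl : Tendsto (fun M : ℕ => (⌊G t * 2 ^ M⌋₊ : ℝ) / 2 ^ M) atTop (𝓝 (G t)) :=
    (tendsto_nat_floor_mul_div_atTop hG).comp
      (tendsto_pow_atTop_atTop_of_one_lt (r := (2 : ℝ)) one_lt_two)
  have hle : ∀ M : ℕ, (⌊G t * 2 ^ M⌋₊ : ℝ) / 2 ^ M ≤ G t := fun M => by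
    rw [div_le_iff₀ (by positivity)]
    exact Nat.floor_le (by positivity)
  have h0 : ∀ M : ℕ, 0 ≤ (⌊G t * 2 ^ M⌋₊ : ℝ) / 2 ^ M := fun M => by positivity
  have hH0 := fun M => h.inv_nonneg _ (h0 M) ((hle M).trans_lt (h.lt_one t ht))
  have hGH := fun M => h.apply_inv _ (h0 M) ((hle M).trans_lt (h.lt_one t ht))
  refine tendsto_order.2 ⟨fun a ha => ?_, fun a ha => Eventually.of_forall fun M => ?_⟩
  · rcases lt_or_ge a 0 with ha0 | ha0
    · exact Eventually.of_forall fun M => ha0.trans_le (hH0 M)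
    · filter_upwards [hl.eventually_const_lt (h.strictMonoOn ha0 ht ha)] with M hM
      rw [← hGH M] at hM
      exact (h.strictMonoOn.lt_iff_lt ha0 (hH0 M)).1 hM
  · refine lt_of_le_of_lt ?_ ha
    rw [← h.le_iff (hH0 M) ht, hGH M]
    exact hle M

lemma tendsto_inv_ceil (h : IsClock G H) {t : ℝ} (ht : 0 ≤ t) :
    Tendsto (fun M : ℕ => H ((⌈G t * 2 ^ M⌉₊ : ℝ) / 2 ^ M)) atTop (𝓝 t) := by
  have hG := h.nonneg t ht
  have hl : Tendsto (fun M : ℕ => (⌈G t * 2 ^ M⌉₊ : ℝ) / 2 ^ M) atTop (𝓝 (G t)) :=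
    (tendsto_nat_ceil_mul_div_atTop hG).comp
      (tendsto_pow_atTop_atTop_of_one_lt (r := (2 : ℝ)) one_lt_two)
  have hle : ∀ M : ℕ, G t ≤ (⌈G t * 2 ^ M⌉₊ : ℝ) / 2 ^ M := fun M => by
    rw [le_div_iff₀ (by positivity)]
    exact Nat.le_ceil _
  have h0 : ∀ M : ℕ, 0 ≤ (⌈G t * 2 ^ M⌉₊ : ℝ) / 2 ^ M := fun M => by positivity
  have hlt1 := hl.eventually_lt_const (h.lt_one t ht)
  refine tendsto_order.2 ⟨fun a ha => ?_, fun a ha => ?_⟩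
  · filter_upwards [hlt1] with M hM
    refine ha.trans_le ?_
    rw [← h.le_iff ht (h.inv_nonneg _ (h0 M) hM), h.apply_inv _ (h0 M) hM]
    exact hle M
  · have ha0 : 0 ≤ a := ht.trans ha.le
    filter_upwards [hlt1, hl.eventually_lt_const (h.strictMonoOn ht ha0 ha)] with M hM hM2
    rw [← h.apply_inv _ (h0 M) hM] at hM2
    exact (h.strictMonoOn.lt_iff_lt (h.inv_nonneg _ (h0 M) hM) ha0).1 hM2

/-- The increments of a continuous function are controlled by its increments over the dyadic
intervals of a clock. -/
lemma norm_sub_le (h : IsClock G H) {Φ : ℝ → ℂ} (hΦ : ContinuousOn Φ (Ici 0)) {s t B ρ : ℝ}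
    (hs : 0 ≤ s) (hst : s ≤ t) (hB : 0 ≤ B) (hρ0 : 0 ≤ ρ) (hρ1 : ρ < 1)
    (hinc : ∀ m i : ℕ, G s ≤ i / 2 ^ m → ((i : ℝ) + 1) / 2 ^ m ≤ G t →
      ‖Φ (H (((i : ℝ) + 1) / 2 ^ m)) - Φ (H (i / 2 ^ m))‖ ≤ B * ρ ^ m) :
    ‖Φ t - Φ s‖ ≤ 2 / (1 - ρ) * B := by
  have hρ : 0 < 1 - ρ := by linarith
  rcases hst.eq_or_lt with rfl | hlt
  · simp only [sub_self, norm_zero]; positivity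
  have ht := hs.trans hst
  have hGs := h.nonneg s hs
  have hGt := h.nonneg t ht
  have l1 := h.tendsto_inv_floor ht
  have l2 := h.tendsto_inv_ceil hs
  have c0 : Tendsto (fun M : ℕ => (⌈G s * 2 ^ M⌉₊ : ℝ) / 2 ^ M) atTop (𝓝 (G s)) :=
    (tendsto_nat_ceil_mul_div_atTop hGs).comp
      (tendsto_pow_atTop_atTop_of_one_lt (r := (2 : ℝ)) one_lt_two)
  have f0 : Tendsto (fun M : ℕ => (⌊G t * 2 ^ M⌋₊ : ℝ) / 2 ^ M) atTop (𝓝 (G t)) :=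
    (tendsto_nat_floor_mul_div_atTop hGt).comp
      (tendsto_pow_atTop_atTop_of_one_lt (r := (2 : ℝ)) one_lt_two)
  have hGlt : G s < G t := h.strictMonoOn hs ht hlt
  have hev := c0.eventually_lt f0 hGlt
  have hlow : ∀ M : ℕ, G s ≤ (⌈G s * 2 ^ M⌉₊ : ℝ) / 2 ^ M := fun M => by
    rw [le_div_iff₀ (by positivity)]
    exact Nat.le_ceil _
  have hup : ∀ M : ℕ, (⌊G t * 2 ^ M⌋₊ : ℝ) / 2 ^ M ≤ G t := fun M => by
    rw [div_le_iff₀ (by positivity)]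
    exact Nat.floor_le (by positivity)
  have hmem1 : ∀ M : ℕ, H ((⌊G t * 2 ^ M⌋₊ : ℝ) / 2 ^ M) ∈ Ici (0 : ℝ) := fun M =>
    h.inv_nonneg _ (by positivity) ((hup M).trans_lt (h.lt_one t ht))
  have hmem2 : ∀ᶠ M : ℕ in atTop, H ((⌈G s * 2 ^ M⌉₊ : ℝ) / 2 ^ M) ∈ Ici (0 : ℝ) := by
    filter_upwards [hev] with M hM
    exact h.inv_nonneg _ (by positivity) (hM.trans_le ((hup M).trans (h.lt_one t ht).le))
  have L1 := (hΦ t ht).tendsto.comp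
    (tendsto_nhdsWithin_iff.2 ⟨l1, Eventually.of_forall hmem1⟩)
  have L2 := (hΦ s hs).tendsto.comp (tendsto_nhdsWithin_iff.2 ⟨l2, hmem2⟩)
  refine le_of_tendsto (L1.sub L2).norm ?_
  filter_upwards [hev] with M hM
  have hij : ⌈G s * 2 ^ M⌉₊ ≤ ⌊G t * 2 ^ M⌋₊ := by
    have : (⌈G s * 2 ^ M⌉₊ : ℝ) < ⌊G t * 2 ^ M⌋₊ := by
      rwa [div_lt_div_iff_of_pos_right (by positivity)] at hM
    exact_mod_cast this.le
  have key := dyadic_chaining (Ψ := fun y => Φ (H y)) (h.lt_one t ht) hB hρ0 hinc M _ _ hij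
    (hlow M) (hup M)
  refine key.trans ?_
  have hgeo : ∑ m ∈ Finset.range (M + 1), ρ ^ m ≤ 1 / (1 - ρ) := by
    rw [one_div, ← tsum_geometric_of_lt_one hρ0 hρ1]
    exact (summable_geometric_of_lt_one hρ0 hρ1).sum_le_tsum _ fun _ _ => by positivity
  calc _ ≤ 2 * B * (1 / (1 - ρ)) := by gcongr
    _ = _ := by ring

end IsClock

/-! ### The control built from dyadic increments -/

/-- The dyadic intervals `[i / 2 ^ m, (i + 1) / 2 ^ m]` in `[0, 1)`. The last interval of each level,
which ends at `1`, is left out: a clock never reaches `1`, so the corresponding set of times is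
unbounded. -/
abbrev DyadicIndex : Type := Σ m : ℕ, Fin (2 ^ m - 1)

lemma summable_dyadicIndex {c : ℕ → ℝ} (hc : ∀ m, 0 ≤ c m)
    (hs : Summable fun m => (2 : ℝ) ^ m * c m) : Summable fun q : DyadicIndex => c q.1 := by
  rw [summable_sigma_of_nonneg fun q => hc q.1]
  refine ⟨fun m => Summable.of_finite, ?_⟩
  refine Summable.of_nonneg_of_le (fun m => tsum_nonneg fun _ => hc m) (fun m => ?_) hs
  rw [tsum_fintype]
  change ∑ _i : Fin (2 ^ m - 1), c m ≤ _
  rw [Finset.sum_const, Finset.card_univ, Fintype.card_fin, nsmul_eq_mul]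
  have := hc m
  gcongr
  exact_mod_cast Nat.sub_le _ _

open Classical in
/-- The sum of the weights `w q` of the dyadic intervals `q` between the clock times of `s` and
`t`. -/
def dyadicControl (G : ℝ → ℝ) (w : DyadicIndex → ℝ) (s t : ℝ) : ℝ :=
  ∑' q : DyadicIndex, if G s ≤ (q.2 : ℝ) / 2 ^ q.1 ∧ ((q.2 : ℝ) + 1) / 2 ^ q.1 ≤ G t then w q else 0

lemma summable_dyadicControl (G : ℝ → ℝ) {w : DyadicIndex → ℝ} (hw0 : ∀ q, 0 ≤ w q)
    (hw : Summable w) (s t : ℝ) : Summable fun q : DyadicIndex => open Classical in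
      if G s ≤ (q.2 : ℝ) / 2 ^ q.1 ∧ ((q.2 : ℝ) + 1) / 2 ^ q.1 ≤ G t then w q else 0 := by
  refine Summable.of_nonneg_of_le (fun q => ?_) (fun q => ?_) hw
  · split_ifs; exacts [hw0 q, le_rfl]
  · split_ifs; exacts [le_rfl, hw0 q]

lemma isControl_dyadicControl {G H : ℝ → ℝ} (h : IsClock G H) {w : DyadicIndex → ℝ}
    (hw0 : ∀ q, 0 ≤ w q) (hw : Summable w) : IsControl (dyadicControl G w) (∑' q, w q) where
  nonneg s t _ _ := tsum_nonneg fun q => by split_ifs; exacts [hw0 q, le_rfl]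
  superadd s u t hs hsu hut := by
    have hS := summable_dyadicControl G hw0 hw
    unfold dyadicControl
    rw [← (hS s u).tsum_add (hS u t)]
    refine ((hS s u).add (hS u t)).tsum_le_tsum (fun q => ?_) (hS s t)
    have h1 : G s ≤ G u := (h.le_iff hs (hs.trans hsu)).2 hsu
    have h2 : G u ≤ G t := (h.le_iff (hs.trans hsu) (hs.trans (hsu.trans hut))).2 hut
    have hlt : (q.2 : ℝ) / 2 ^ q.1 < ((q.2 : ℝ) + 1) / 2 ^ q.1 := by
      gcongr; linarith
    have := hw0 q
    split_ifs with c1 c2 c3 c4 c5 c6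
    · linarith [c1.2, c2.1]
    · linarith [c1.2, c2.1]
    · linarith
    · exact absurd ⟨c1.1, c1.2.trans h2⟩ c4
    · linarith
    · exact absurd ⟨h1.trans c5.1, c5.2⟩ c6
    · linarith
    · linarith
  le_bound s t _ _ := (summable_dyadicControl G hw0 hw s t).tsum_le_tsum
    (fun q => by split_ifs; exacts [le_rfl, hw0 q]) hw

/-- If the squares of the increments over dyadic intervals are summable with the weights
`2 ^ (a * m)`, then all increments are controlled with an exponent larger than `1 / 2`. -/
lemma exists_control {ι : Type*} [Fintype ι] {G H : ℝ → ℝ} (h : IsClock G H) {φ : ι → ℝ → ℂ}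
    (hφ : ∀ j T, IntegrableOn (φ j) (Ioc 0 T)) {a : ℝ} (ha : 0 < a)
    (hsum : ∀ j, Summable fun q : DyadicIndex => (2 : ℝ) ^ (a * q.1) *
      ‖∫ x in Ioc (H ((q.2 : ℝ) / 2 ^ q.1)) (H (((q.2 : ℝ) + 1) / 2 ^ q.1)), φ j x‖ ^ 2) :
    ∃ (ω : ℝ → ℝ → ℝ) (W β K : ℝ), IsControl ω W ∧ 1 / 2 < β ∧ 0 ≤ K ∧
      ∀ j s t, 0 ≤ s → s ≤ t → ‖∫ x in s..t, φ j x‖ ≤ K * ω s t ^ β := by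
  set inc : ι → DyadicIndex → ℝ := fun j q =>
    ‖∫ x in Ioc (H ((q.2 : ℝ) / 2 ^ q.1)) (H (((q.2 : ℝ) + 1) / 2 ^ q.1)), φ j x‖ with hinc
  set w : DyadicIndex → ℝ := fun q =>
    (∑ j, (2 : ℝ) ^ (a * q.1) * inc j q ^ 2) + (1 / 4 : ℝ) ^ q.1 with hw
  have hterm0 : ∀ j q, 0 ≤ (2 : ℝ) ^ (a * q.1) * inc j q ^ 2 := fun j q => by positivity
  have hw0 : ∀ q, 0 ≤ w q := fun q =>
    add_nonneg (Finset.sum_nonneg fun j _ => hterm0 j q) (by positivity)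
  have hgeo : Summable fun q : DyadicIndex => (1 / 4 : ℝ) ^ q.1 := by
    refine summable_dyadicIndex (fun m => by positivity) ?_
    simp_rw [← mul_pow]
    exact summable_geometric_of_lt_one (by norm_num) (by norm_num)
  have hws : Summable w := (summable_sum fun j _ => hsum j).add hgeo
  set β : ℝ := 1 / 2 + a / 8 with hβ
  set ρ : ℝ := (2 : ℝ) ^ (-(a / 4)) with hρ
  have hρ0 : 0 < ρ := by positivity
  have hρ1 : ρ < 1 := Real.rpow_lt_one_of_one_lt_of_neg one_lt_two (by linarith)
  have hC := isControl_dyadicControl h hw0 hws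
  -- the weight exceeds both `2 ^ (a * m) * x ^ 2` and `2 ^ (-2 * m)`; interpolation gives
  -- `x * 2 ^ (a * m / 4) ≤ w ^ β`
  have hpt : ∀ j q, inc j q ≤ w q ^ β * ρ ^ q.1 := by
    intro j q
    have h1 : (2 : ℝ) ^ (a * q.1) * inc j q ^ 2 ≤ w q := by
      have := Finset.single_le_sum (fun j _ => hterm0 j q) (Finset.mem_univ j)
      have h4 : (0 : ℝ) ≤ (1 / 4 : ℝ) ^ q.1 := by positivity
      simp only [hw]; linarith
    have h2 : (1 / 4 : ℝ) ^ q.1 ≤ w q := by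
      have := Finset.sum_nonneg fun j (_ : j ∈ Finset.univ) => hterm0 j q
      simp only [hw]; linarith
    have hi0 : 0 ≤ inc j q := norm_nonneg _
    have e1 : ((2 : ℝ) ^ (a * q.1) * inc j q ^ 2) ^ (1 / 2 : ℝ) =
        (2 : ℝ) ^ (a * q.1 / 2) * inc j q := by
      rw [Real.mul_rpow (by positivity) (by positivity), ← Real.rpow_mul (by norm_num),
        ← Real.sqrt_eq_rpow, Real.sqrt_sq hi0]
      congr 2; ring
    have e2 : ((1 / 4 : ℝ) ^ q.1) ^ (a / 8) = (2 : ℝ) ^ (-(a * q.1 / 4)) := by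
      rw [show (1 / 4 : ℝ) = (2 : ℝ) ^ (-2 : ℝ) by
        rw [Real.rpow_neg (by norm_num)]; norm_num,
        ← Real.rpow_natCast, ← Real.rpow_mul (by norm_num),
        ← Real.rpow_mul (by norm_num)]
      congr 1; ring
    have e3 : w q ^ β = w q ^ (1 / 2 : ℝ) * w q ^ (a / 8) :=
      Real.rpow_add_of_nonneg (hw0 q) (by norm_num) (by positivity)
    have e4 : ρ ^ q.1 = (2 : ℝ) ^ (-(a * q.1 / 4)) := by
      rw [hρ, ← Real.rpow_natCast, ← Real.rpow_mul (by norm_num)]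
      congr 1; ring
    calc inc j q = ((2 : ℝ) ^ (a * q.1 / 2) * inc j q * (2 : ℝ) ^ (-(a * q.1 / 4))) *
          (2 : ℝ) ^ (-(a * q.1 / 4)) := by
          have : (2 : ℝ) ^ (a * q.1 / 2) * (2 : ℝ) ^ (-(a * q.1 / 4)) *
              (2 : ℝ) ^ (-(a * q.1 / 4)) = 1 := by
            rw [← Real.rpow_add two_pos, ← Real.rpow_add two_pos]
            rw [show a * q.1 / 2 + -(a * q.1 / 4) + -(a * q.1 / 4) = 0 by ring, Real.rpow_zero]
          linear_combination (-inc j q) * this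
      _ ≤ (w q ^ (1 / 2 : ℝ) * w q ^ (a / 8)) * (2 : ℝ) ^ (-(a * q.1 / 4)) := by
          rw [← e1]
          nth_rw 1 [← e2]
          gcongr
      _ = _ := by rw [e3, e4]
  refine ⟨dyadicControl G w, ∑' q, w q, β, 2 / (1 - ρ), hC, by rw [hβ]; linarith,
    div_nonneg two_pos.le (by linarith), fun j s t hs hst => ?_⟩
  have hii : ∀ u v, 0 ≤ u → u ≤ v → IntervalIntegrable (φ j) volume u v := fun u v hu huv =>
    (intervalIntegrable_iff_integrableOn_Ioc_of_le huv).2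
      ((hφ j v).mono_set (Ioc_subset_Ioc_left hu))
  set Φ : ℝ → ℂ := fun t => ∫ x in (0 : ℝ)..t, φ j x with hΦ
  have hsub : ∀ u v, 0 ≤ u → u ≤ v → Φ v - Φ u = ∫ x in u..v, φ j x := fun u v hu huv =>
    intervalIntegral.integral_interval_sub_left (hii 0 v le_rfl (hu.trans huv)) (hii 0 u le_rfl hu)
  have hcont : ContinuousOn Φ (Ici 0) := by
    intro u hu
    have hu : (0 : ℝ) ≤ u := hu
    have := intervalIntegral.continuousOn_primitive_interval (a := (0 : ℝ)) (b := u + 1)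
      (μ := volume) (f := φ j) (by
        rw [uIcc_of_le (by linarith), integrableOn_Icc_iff_integrableOn_Ioc]
        exact hφ j _)
    rw [uIcc_of_le (by linarith)] at this
    have h1 := this u ⟨hu, by linarith⟩
    refine h1.mono_of_mem_nhdsWithin ?_
    rw [← Ici_inter_Iic]
    exact inter_mem_nhdsWithin _ (Iic_mem_nhds (lt_add_one u))
  rw [← hsub s t hs hst]
  have hω0 := hC.nonneg s t hs hst
  refine h.norm_sub_le hcont hs hst (Real.rpow_nonneg hω0 β) hρ0.le hρ1 fun m i hi1 hi2 => ?_
  have hlt1 : ((i : ℝ) + 1) / 2 ^ m < 1 := hi2.trans_lt (h.lt_one t (hs.trans hst))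
  have hi : i < 2 ^ m - 1 := by
    rw [div_lt_one (by positivity)] at hlt1
    have : i + 1 < 2 ^ m := by exact_mod_cast hlt1
    omega
  have hle : (i : ℝ) / 2 ^ m ≤ ((i : ℝ) + 1) / 2 ^ m := by
    gcongr; linarith
  have hi0 : (0 : ℝ) ≤ (i : ℝ) / 2 ^ m := by positivity
  have hHle := h.inv_le_inv hi0 hle hlt1
  rw [hsub _ _ (h.inv_nonneg _ hi0 (hle.trans_lt hlt1)) hHle, intervalIntegral.integral_of_le hHle]
  refine (hpt j ⟨m, i, hi⟩).trans ?_
  have hwle : w ⟨m, i, hi⟩ ≤ dyadicControl G w s t := by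
    have := (summable_dyadicControl G hw0 hws s t).le_tsum ⟨m, i, hi⟩ (fun q _ => by
      split_ifs; exacts [hw0 q, le_rfl])
    rwa [if_pos ⟨hi1, hi2⟩] at this
  have := hw0 ⟨m, i, hi⟩
  gcongr

/-! ### Decomposition into ordered simplices -/

/-- The ordered simplex `{0 < y_0 < ⋯ < y_{n-1} < t}`. -/
def orderedSimplex (n : ℕ) (t : ℝ) : Set (Fin n → ℝ) :=
  {y | StrictMono y ∧ ∀ i, y i ∈ Ioo 0 t}

lemma measurableSet_orderedSimplex (n : ℕ) (t : ℝ) : MeasurableSet (orderedSimplex n t) := by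
  refine MeasurableSet.inter ?_ ?_
  · have : {y : Fin n → ℝ | StrictMono y} = ⋂ i, ⋂ j, ⋂ _ : i < j, {y | y i < y j} := by
      ext y; simp [StrictMono]
    change MeasurableSet {y : Fin n → ℝ | StrictMono y}
    rw [this]
    exact MeasurableSet.iInter fun i => MeasurableSet.iInter fun j => MeasurableSet.iInter fun _ =>
      measurableSet_lt (measurable_pi_apply i) (measurable_pi_apply j)
  · change MeasurableSet {y : Fin n → ℝ | ∀ i, y i ∈ Ioo 0 t}
    rw [ofPred_forall]
    exact MeasurableSet.iInter fun i => measurable_pi_apply i measurableSet_Ioo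

lemma mem_orderedSimplex_succ {n : ℕ} {t : ℝ} {y : Fin (n + 1) → ℝ} :
    y ∈ orderedSimplex (n + 1) t ↔ y (Fin.last n) ∈ Ioo 0 t ∧
      (fun i : Fin n => y i.castSucc) ∈ orderedSimplex n (y (Fin.last n)) := by
  constructor
  · rintro ⟨h1, h2⟩
    exact ⟨h2 _, fun i j hij => h1 (Fin.castSucc_lt_castSucc_iff.2 hij),
      fun i => ⟨(h2 _).1, h1 (Fin.castSucc_lt_last i)⟩⟩
  · rintro ⟨h1, h2, h3⟩
    refine ⟨fun i j hij => ?_, fun i => ?_⟩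
    · induction j using Fin.lastCases with
      | last =>
        induction i using Fin.lastCases with
        | last => exact absurd hij (lt_irrefl _)
        | cast i => exact (h3 i).2
      | cast j =>
        induction i using Fin.lastCases with
        | last => exact absurd hij (not_lt.2 (Fin.castSucc_lt_last j).le)
        | cast i => exact h2 (Fin.castSucc_lt_castSucc_iff.1 hij)
    · induction i using Fin.lastCases with
      | last => exact h1
      | cast i => exact ⟨(h3 i).1, (h3 i).2.trans h1.2⟩

/-- Fubini's theorem for the ordered simplex. -/
lemma integral_orderedSimplex (n : ℕ) : ∀ {ψ : Fin n → ℝ → ℂ}, (∀ i, Integrable (ψ i)) →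
    ∀ {t : ℝ}, 0 ≤ t →
    ∫ y in orderedSimplex n t, ∏ i, ψ i (y i) = iteratedIntegral n ψ t := by
  induction n with
  | zero =>
    intro ψ _ t _
    have h : orderedSimplex 0 t = univ := by
      ext y; simp [orderedSimplex, Subsingleton.strictMono]
    rw [h]
    simp [iteratedIntegral, integral_unique, Measure.real, volume_pi]
  | succ n ih =>
    intro ψ hψ t ht
    set e := MeasurableEquiv.piFinSuccAbove (fun _ : Fin (n + 1) => ℝ) (Fin.last n)
    have he : MeasurePreserving e volume (volume.prod volume) :=
      volume_preserving_piFinSuccAbove (fun _ : Fin (n + 1) => ℝ) (Fin.last n)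
    set g : ℝ × (Fin n → ℝ) → ℂ := fun z => (Ioo 0 t).indicator (fun x =>
      (orderedSimplex n x).indicator
        (fun y => (∏ i, ψ i.castSucc (y i)) * ψ (Fin.last n) x) z.2) z.1
      with hg
    have hge : ∀ y, g (e y) =
        (orderedSimplex (n + 1) t).indicator (fun y => ∏ i, ψ i (y i)) y := by
      intro y
      have e1 : (e y).1 = y (Fin.last n) := rfl
      have e2 : (e y).2 = fun i : Fin n => y i.castSucc := by
        ext i
        simp [e, MeasurableEquiv.piFinSuccAbove, Fin.init]
      simp only [hg, e1, e2]
      by_cases h1 : y (Fin.last n) ∈ Ioo 0 t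
      · by_cases h2 : (fun i : Fin n => y i.castSucc) ∈ orderedSimplex n (y (Fin.last n))
        · rw [indicator_of_mem h1, indicator_of_mem h2,
            indicator_of_mem (mem_orderedSimplex_succ.2 ⟨h1, h2⟩), Fin.prod_univ_castSucc]
        · rw [indicator_of_mem h1, indicator_of_notMem h2,
            indicator_of_notMem fun h => h2 (mem_orderedSimplex_succ.1 h).2]
      · rw [indicator_of_notMem h1,
            indicator_of_notMem fun h => h1 (mem_orderedSimplex_succ.1 h).1]
    have hgi : Integrable g (volume.prod volume) := by
      rw [← he.integrable_comp_emb e.measurableEmbedding]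
      have : g ∘ e = (orderedSimplex (n + 1) t).indicator (fun y => ∏ i, ψ i (y i)) :=
        funext hge
      rw [this]
      exact (Integrable.fintype_prod hψ).indicator (measurableSet_orderedSimplex _ _)
    rw [← integral_indicator (measurableSet_orderedSimplex _ _)]
    simp_rw [← hge]
    rw [he.integral_comp', integral_prod _ hgi]
    have : ∀ x, ∫ y, g (x, y) = (Ioo 0 t).indicator (fun x =>
        iteratedIntegral n (fun i => ψ i.castSucc) x * ψ (Fin.last n) x) x := by
      intro x
      by_cases hx : x ∈ Ioo 0 t
      · simp only [hg, indicator_of_mem hx]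
        rw [integral_indicator (measurableSet_orderedSimplex _ _), integral_mul_const,
          ih (fun i => hψ i.castSucc) hx.1.le]
      · simp only [hg, indicator_of_notMem hx, integral_zero]
    simp_rw [this]
    rw [integral_indicator measurableSet_Ioo, iteratedIntegral,
      intervalIntegral.integral_of_le ht, integral_Ioc_eq_integral_Ioo]

/-- The value of `∏ χ(x_a - x_b)` over `(a, b) ∈ A` at points with `x ∘ σ` increasing. -/
def orderCoeff {n : ℕ} (A : Finset (Fin n × Fin n)) (σ : Equiv.Perm (Fin n)) : ℂ :=
  ∏ a ∈ A, if σ.symm a.2 < σ.symm a.1 then 1 else 0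

lemma prod_chiPos_eq_orderCoeff {n : ℕ} (A : Finset (Fin n × Fin n)) {σ : Equiv.Perm (Fin n)}
    {x : Fin n → ℝ} (h : StrictMono (x ∘ σ)) :
    ∏ a ∈ A, chiPos (x a.1 - x a.2) = orderCoeff A σ := by
  refine Finset.prod_congr rfl fun a _ => ?_
  have := h.lt_iff_lt (a := σ.symm a.2) (b := σ.symm a.1)
  simp only [Function.comp_apply, Equiv.apply_symm_apply] at this
  by_cases hlt : x a.2 < x a.1
  · rw [if_pos (this.1 hlt)]
    simp [chiPos, hlt]
  · rw [if_neg fun h => hlt (this.2 h)]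
    simp [chiPos, not_lt.1 hlt]

/-- The points of `ℝⁿ` without coincident coordinates are arranged in increasing order by exactly
one permutation. -/
lemma existsUnique_perm_strictMono {n : ℕ} {x : Fin n → ℝ} (hx : Function.Injective x) :
    ∃! σ : Equiv.Perm (Fin n), StrictMono (x ∘ σ) := by
  refine ⟨Tuple.sort x, (Tuple.monotone_sort x).strictMono_of_injective
    (hx.comp (Tuple.sort x).injective), fun τ hτ => ?_⟩
  have h := Tuple.unique_monotone hτ.monotone (Tuple.monotone_sort x)
  ext i
  exact congrArg Fin.val (hx (congrFun h i))

lemma ae_injective (n : ℕ) : ∀ᵐ x : Fin n → ℝ, Function.Injective x := by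
  have : ∀ i j : Fin n, i ≠ j → ∀ᵐ x : Fin n → ℝ, x i ≠ x j := by
    intro i j hij
    let L : (Fin n → ℝ) →ₗ[ℝ] ℝ := 
      (LinearMap.proj i : (Fin n → ℝ) →ₗ[ℝ] ℝ) - (LinearMap.proj j : (Fin n → ℝ) →ₗ[ℝ] ℝ)
    have hL : LinearMap.ker L ≠ ⊤ := by
      intro h
      have : L (Pi.single i 1) = 0 := by
        rw [← LinearMap.mem_ker, h]; trivial
      simp [L, hij] at this
    have := Measure.addHaar_submodule (volume : Measure (Fin n → ℝ)) _ hL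
    rw [ae_iff]
    convert this using 2
    ext x
    simp [L, sub_eq_zero]
  filter_upwards [ae_all_iff.2 fun i => ae_all_iff.2 fun j =>
    (ae_all_iff.2 fun h : i ≠ j => this i j h)] with x hx i j hij
  by_contra hne
  exact hx i j hne hij

/-- Up to a null set, the set cut out by the factors `χ(x_a - x_b)` is a disjoint union of
permuted ordered simplices. -/
lemma integral_prod_chiPos {n : ℕ} (A : Finset (Fin n × Fin n)) {ψ : Fin n → ℝ → ℂ}
    (hψ : ∀ i, Integrable (ψ i)) {t : ℝ} (ht : 0 ≤ t) (h0 : ∀ i x, x ≤ 0 → ψ i x = 0)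
    (ht0 : ∀ i x, t ≤ x → ψ i x = 0) :
    ∫ x : Fin n → ℝ, (∏ i, ψ i (x i)) * ∏ a ∈ A, chiPos (x a.1 - x a.2) =
      ∑ σ : Equiv.Perm (Fin n), orderCoeff A σ * iteratedIntegral n (fun i => ψ (σ i)) t := by
  have hpre : ∀ σ : Equiv.Perm (Fin n), MeasurePreserving
      (MeasurableEquiv.arrowCongr' σ.symm (MeasurableEquiv.refl ℝ)) volume volume := fun σ =>
    volume_preserving_arrowCongr' σ.symm (MeasurableEquiv.refl ℝ) (MeasurePreserving.id _)
  set h : Equiv.Perm (Fin n) → (Fin n → ℝ) → ℂ := fun σ =>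
    (orderedSimplex n t).indicator fun y => ∏ i, ψ (σ i) (y i) with hh
  have hi : ∀ σ, Integrable (h σ) := fun σ =>
    (Integrable.fintype_prod fun i => hψ (σ i)).indicator (measurableSet_orderedSimplex _ _)
  have hcomp : ∀ (σ : Equiv.Perm (Fin n)) (x : Fin n → ℝ),
      MeasurableEquiv.arrowCongr' σ.symm (MeasurableEquiv.refl ℝ) x = x ∘ σ := fun σ x => rfl
  have hint : ∀ σ : Equiv.Perm (Fin n), Integrable (fun x => h σ (x ∘ σ)) := fun σ =>
    (hpre σ).integrable_comp_of_integrable (hi σ)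
  have hval : ∀ σ : Equiv.Perm (Fin n), ∫ x, h σ (x ∘ σ) =
      iteratedIntegral n (fun i => ψ (σ i)) t := by
    intro σ
    rw [← integral_orderedSimplex n (fun i => hψ (σ i)) ht,
      ← integral_indicator (measurableSet_orderedSimplex _ _)]
    exact (hpre σ).integral_comp' (h σ)
  calc _ = ∫ x : Fin n → ℝ, ∑ σ : Equiv.Perm (Fin n), orderCoeff A σ * h σ (x ∘ σ) := by
        refine integral_congr_ae ?_
        filter_upwards [ae_injective n] with x hx
        obtain ⟨σ, hσ, huniq⟩ := existsUnique_perm_strictMono hx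
        rw [Finset.sum_eq_single σ]
        · rw [prod_chiPos_eq_orderCoeff A hσ, mul_comm]
          congr 1
          rw [← Equiv.prod_comp σ]
          by_cases hmem : x ∘ σ ∈ orderedSimplex n t
          · simp only [hh, indicator_of_mem hmem, Function.comp_apply]
          · simp only [hh, indicator_of_notMem hmem]
            have : ∃ i, x (σ i) ∉ Ioo 0 t := by
              by_contra! hcon
              exact hmem ⟨hσ, hcon⟩
            obtain ⟨i, hi⟩ := this
            refine Finset.prod_eq_zero (Finset.mem_univ i) ?_
            by_cases hx0 : x (σ i) ≤ 0
            · exact h0 _ _ hx0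
            · exact ht0 _ _ (not_lt.1 fun hlt => hi ⟨not_le.1 hx0, hlt⟩)
        · intro τ _ hτ
          have : x ∘ τ ∉ orderedSimplex n t := fun hmem => hτ (huniq τ hmem.1)
          simp only [hh, indicator_of_notMem this, mul_zero]
        · simp
    _ = _ := by
        rw [integral_finsetSum _ fun σ _ => (hint σ).const_mul _]
        refine Finset.sum_congr rfl fun σ _ => ?_
        rw [integral_const_mul, hval]

/-! ### The dyadic square function -/

lemma IsBoundedKernel.aestronglyMeasurable_prod {I : Set ℝ} {k : ℝ → ℝ → ℂ}
    (hk : IsBoundedKernel I k) : AEStronglyMeasurable (Function.uncurry k)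
      ((volume.restrict I).prod (volume.restrict (Ioi (0 : ℝ)))) := by
  rw [Measure.prod_restrict]
  exact hk.1

lemma IsBoundedKernel.ae_slice {I : Set ℝ} (hI : NullMeasurableSet I) {k : ℝ → ℝ → ℂ}
    (hk : IsBoundedKernel I k) : ∃ M : ℝ, 0 ≤ M ∧ ∀ᵐ l ∂(volume.restrict I),
      AEStronglyMeasurable (k l) (volume.restrict (Ioi (0 : ℝ))) ∧ ∀ x, 0 < x → ‖k l x‖ ≤ M := by
  obtain ⟨M, hM⟩ := hk.2
  refine ⟨max M 0, le_max_right _ _, ?_⟩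
  filter_upwards [hk.aestronglyMeasurable_prod.prodMk_left, ae_restrict_mem₀ hI] with l h1 h2
  exact ⟨h1, fun x hx => (hM l h2 x hx).trans (le_max_left _ _)⟩

lemma IsBoundedKernel.aestronglyMeasurable_kernelOp {I : Set ℝ} {k : ℝ → ℝ → ℂ}
    (hk : IsBoundedKernel I k) {g : ℝ → ℂ} (hg : StronglyMeasurable g) :
    AEStronglyMeasurable (kernelOp k g) (volume.restrict I) :=
  (hk.aestronglyMeasurable_prod.mul
    (hg.comp_measurable measurable_snd).aestronglyMeasurable).integral_prod_right'

/-- The `L²` bound in the form of an inequality between integrals of squares. -/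
lemma SatisfiesL2Bound.lintegral_sq_le {I : Set ℝ} {k : ℝ → ℝ → ℂ} (hK : SatisfiesL2Bound I k) :
    ∃ C : ℝ, 0 ≤ C ∧ ∀ g : ℝ → ℂ, Measurable g → (∃ B : ℝ, ∀ x, ‖g x‖ ≤ B) → HasCompactSupport g →
      ∀ S : ℝ, 0 ≤ S → ∫⁻ x in Ioi (0 : ℝ), ‖g x‖ₑ ^ 2 ≤ ENNReal.ofReal S →
      ∫⁻ l in I, ‖kernelOp k g l‖ₑ ^ 2 ≤ ENNReal.ofReal (C * S) := by
  obtain ⟨C, hC⟩ := hK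
  refine ⟨(C : ℝ) ^ 2, by positivity, fun g hg hb hs S hS hle => ?_⟩
  have hsq : ∀ (F : ℝ → ℂ) (ν : Measure ℝ), eLpNorm F 2 ν ^ 2 = ∫⁻ x, ‖F x‖ₑ ^ 2 ∂ν := by
    intro F ν
    have := eLpNorm_nnreal_pow_eq_lintegral (f := F) (μ := ν) (p := 2) (by norm_num)
    simpa using this
  rw [← hsq] at hle ⊢
  calc _ ≤ ((C : ENNReal) * eLpNorm g 2 (volume.restrict (Ioi (0 : ℝ)))) ^ 2 := by
        gcongr
        exact hC g hg hb hs
    _ = (C : ENNReal) ^ 2 * eLpNorm g 2 (volume.restrict (Ioi (0 : ℝ))) ^ 2 := mul_pow _ _ _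
    _ ≤ (C : ENNReal) ^ 2 * ENNReal.ofReal S := by gcongr
    _ = _ := by
      rw [ENNReal.ofReal_mul (by positivity), ENNReal.ofReal_pow (by positivity),
        ENNReal.ofReal_coe_nnreal]

/-- The part of `g` on `J` where `‖g‖ ≤ h`. -/
def lowPart (g : ℝ → ℂ) (J : Set ℝ) (h : ℝ) : ℝ → ℂ := (J ∩ {x | ‖g x‖ ≤ h}).indicator g

lemma measurableSet_low {g : ℝ → ℂ} (hg : StronglyMeasurable g) (h : ℝ) :
    MeasurableSet {x | ‖g x‖ ≤ h} := measurableSet_le hg.norm.measurable measurable_const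

lemma lintegral_lowPart_sq_le {g : ℝ → ℂ} {s t h p S : ℝ} (hh : 0 < h)
    (hp2 : p < 2)
    (hgp : IntegrableOn (fun x => ‖g x‖ ^ p) (Ioc s t)) (hS : ∫ x in Ioc s t, ‖g x‖ ^ p ≤ S) :
    ∫⁻ x in Ioi (0 : ℝ), ‖lowPart g (Ioc s t) h x‖ₑ ^ 2 ≤ ENNReal.ofReal (h ^ (2 - p) * S) := by
  have hpt : ∀ x, ‖lowPart g (Ioc s t) h x‖ₑ ^ 2 ≤
      (Ioc s t).indicator (fun x => ENNReal.ofReal (h ^ (2 - p) * ‖g x‖ ^ p)) x := by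
    intro x
    unfold lowPart
    by_cases hx : x ∈ Ioc s t ∩ {x | ‖g x‖ ≤ h}
    · rw [indicator_of_mem hx, indicator_of_mem hx.1, ← ofReal_norm, ← ENNReal.ofReal_pow
        (norm_nonneg _)]
      refine ENNReal.ofReal_le_ofReal ?_
      rcases (norm_nonneg (g x)).eq_or_lt with h0 | h0
      · rw [← h0]; simp only [ne_eq, OfNat.ofNat_ne_zero, not_false_eq_true, zero_pow]; positivity
      calc ‖g x‖ ^ 2 = ‖g x‖ ^ (2 - p) * ‖g x‖ ^ p := by
            rw [← Real.rpow_add h0, sub_add_cancel, Real.rpow_two]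
        _ ≤ _ := by
            gcongr
            exact hx.2
    · rw [indicator_of_notMem hx]; simp
  calc _ ≤ ∫⁻ x, ‖lowPart g (Ioc s t) h x‖ₑ ^ 2 := setLIntegral_le_lintegral _ _
    _ ≤ ∫⁻ x in Ioc s t, ENNReal.ofReal (h ^ (2 - p) * ‖g x‖ ^ p) := by
        rw [← lintegral_indicator measurableSet_Ioc]
        exact lintegral_mono hpt
    _ = ENNReal.ofReal (∫ x in Ioc s t, h ^ (2 - p) * ‖g x‖ ^ p) := by
        rw [ofReal_integral_eq_lintegral_ofReal (hgp.const_mul _)]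
        exact ae_of_all _ fun x => by positivity
    _ ≤ _ := by
        rw [integral_const_mul]
        gcongr

/-- Above the height `h`, the `L¹` norm is controlled by the `L^p` norm, so that a bounded kernel
suffices. -/
lemma norm_integral_sub_lowPart_le {g κ : ℝ → ℂ} {s t h p S M : ℝ} (hs : 0 ≤ s) (hh : 0 < h)
    (hp1 : 1 ≤ p) (hM : 0 ≤ M) (hg : StronglyMeasurable g)
    (hκ : AEStronglyMeasurable κ (volume.restrict (Ioi (0 : ℝ)))) (hκM : ∀ x, 0 < x → ‖κ x‖ ≤ M)
    (hgi : IntegrableOn g (Ioc s t))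
    (hgp : IntegrableOn (fun x => ‖g x‖ ^ p) (Ioc s t)) (hS : ∫ x in Ioc s t, ‖g x‖ ^ p ≤ S) :
    ‖(∫ x in Ioc s t, g x * κ x) - ∫ x in Ioi (0 : ℝ), κ x * lowPart g (Ioc s t) h x‖ ≤
      M * (h ^ (1 - p) * S) := by
  have hsub : Ioc s t ⊆ Ioi 0 := fun x hx => hs.trans_lt hx.1
  have hmul : IntegrableOn (fun x => g x * κ x) (Ioc s t) :=
    hgi.mul_bdd (c := M) (hκ.mono_measure (Measure.restrict_mono hsub le_rfl)) (by
      filter_upwards [ae_restrict_mem measurableSet_Ioc] with x hx using hκM x (hsub hx))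
  have e1 : ∫ x in Ioi (0 : ℝ), κ x * lowPart g (Ioc s t) h x =
      ∫ x in Ioc s t, {x | ‖g x‖ ≤ h}.indicator (fun x => g x * κ x) x := by
    rw [← integral_indicator measurableSet_Ioc, ← integral_indicator measurableSet_Ioi]
    congr 1; ext x
    unfold lowPart
    by_cases hx : x ∈ Ioc s t
    · by_cases hx2 : ‖g x‖ ≤ h
      · rw [indicator_of_mem (hsub hx),
          indicator_of_mem (show x ∈ Ioc s t ∩ {x | ‖g x‖ ≤ h} from ⟨hx, hx2⟩),
          indicator_of_mem hx,
          indicator_of_mem (by exact hx2), mul_comm]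
      · rw [indicator_of_mem (hsub hx), indicator_of_notMem fun h => hx2 h.2, indicator_of_mem hx,
          indicator_of_notMem (by exact hx2), mul_zero]
    · rw [indicator_of_notMem hx (f := fun x => _)]
      simp only [indicator_apply, mem_inter_iff, hx, false_and, if_false, mul_zero, ite_self]
  rw [e1, ← integral_sub hmul (hmul.indicator (measurableSet_low hg h))]
  calc _ ≤ ∫ x in Ioc s t, M * (h ^ (1 - p) * ‖g x‖ ^ p) := by
        refine norm_integral_le_of_norm_le ((hgp.const_mul _).const_mul _) ?_
        filter_upwards [ae_restrict_mem measurableSet_Ioc] with x hx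
        by_cases hx2 : ‖g x‖ ≤ h
        · rw [indicator_of_mem (by exact hx2), sub_self, norm_zero]; positivity
        · rw [indicator_of_notMem (by exact hx2), sub_zero, norm_mul, mul_comm]
          have hgt : h < ‖g x‖ := not_le.1 hx2
          have h0 : 0 < ‖g x‖ := hh.trans hgt
          gcongr
          · exact hκM x (hsub hx)
          · calc ‖g x‖ = ‖g x‖ ^ (1 - p) * ‖g x‖ ^ p := by
                  rw [← Real.rpow_add h0, sub_add_cancel, Real.rpow_one]
              _ ≤ _ := mul_le_mul_of_nonneg_right
                  (Real.rpow_le_rpow_of_nonpos hh hgt.le (sub_nonpos.2 hp1)) (by positivity)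
    _ ≤ _ := by
        rw [integral_const_mul, integral_const_mul]
        gcongr

lemma memLp_integrableOn_Ioc {f : ℝ → ℂ} {p : ENNReal} (hp1 : 1 ≤ p)
    (hf : MemLp f p (volume.restrict (Ioi (0 : ℝ)))) {s t : ℝ} (hs : 0 ≤ s) :
    IntegrableOn f (Ioc s t) :=
  (hf.mono_measure (Measure.restrict_mono (fun _ hx => hs.trans_lt hx.1) le_rfl)).integrable hp1

/-- Almost everywhere finiteness of the dyadic square function, with a geometric gain. On an
interval of level `m` the function is split at the height `2 ^ (-m / 4)`: the `L²` bound applies to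
the part below, and the boundedness of the kernel to the part above. -/
lemma ae_summable_dyadic {I : Set ℝ} (hI : NullMeasurableSet I) {k : ℝ → ℝ → ℂ}
    (hk : IsBoundedKernel I k) (hK : SatisfiesL2Bound I k) {p : ENNReal} (hp1 : 1 ≤ p) (hp2 : p < 2)
    {f : ℝ → ℂ} (hf : MemLp f p (volume.restrict (Ioi (0 : ℝ)))) {G H : ℝ → ℝ} (hc : IsClock G H)
    {L : ℝ} (hL : 0 ≤ L)
    (hfL : ∀ s t, 0 ≤ s → s ≤ t → ∫ x in Ioc s t, ‖f x‖ ^ p.toReal ≤ L * (G t - G s)) :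
    ∀ᵐ l ∂(volume.restrict I), Summable fun q : DyadicIndex =>
      (2 : ℝ) ^ ((2 - p.toReal) / 8 * q.1) *
      ‖∫ x in Ioc (H ((q.2 : ℝ) / 2 ^ q.1)) (H (((q.2 : ℝ) + 1) / 2 ^ q.1)), f x * k l x‖ ^ 2 := by
  have hptop : p ≠ ⊤ := (hp2.trans (by simp)).ne
  set r := p.toReal with hr
  have hr1 : 1 ≤ r := by
    have := ENNReal.toReal_mono hptop hp1; simpa using this
  have hr2 : r < 2 := by
    have := (ENNReal.toReal_lt_toReal hptop (by simp)).2 hp2; simpa using this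
  set g := hf.1.mk f with hg
  have hgm : StronglyMeasurable g := hf.1.stronglyMeasurable_mk
  have hfg : f =ᵐ[volume.restrict (Ioi 0)] g := hf.1.ae_eq_mk
  have hgLp : MemLp g p (volume.restrict (Ioi (0 : ℝ))) := hf.ae_eq hfg
  have hgpi : IntegrableOn (fun x => ‖g x‖ ^ r) (Ioi 0) :=
    hgLp.integrable_norm_rpow (zero_lt_one.trans_le hp1).ne' hptop
  have hsubI : ∀ {s t : ℝ}, 0 ≤ s → Ioc s t ⊆ Ioi 0 := fun hs x hx => hs.trans_lt hx.1
  have hfgI : ∀ {s t : ℝ}, 0 ≤ s → f =ᵐ[volume.restrict (Ioc s t)] g := fun hs =>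
    ae_restrict_of_ae_restrict_of_subset (hsubI hs) hfg
  obtain ⟨M, hM, hslice⟩ := hk.ae_slice hI
  obtain ⟨C, hC, hCK⟩ := hK.lintegral_sq_le
  set lo : DyadicIndex → ℝ := fun q => H ((q.2 : ℝ) / 2 ^ q.1) with hlo
  set hi : DyadicIndex → ℝ := fun q => H (((q.2 : ℝ) + 1) / 2 ^ q.1) with hhi
  set ht : DyadicIndex → ℝ := fun q => (2 : ℝ) ^ (-(q.1 : ℝ) / 4) with hht
  have hht0 : ∀ q, 0 < ht q := fun q => by positivity
  have hlt1 : ∀ q : DyadicIndex, ((q.2 : ℝ) + 1) / 2 ^ q.1 < 1 := fun q => by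
    rw [div_lt_one (by positivity)]
    have := q.2.2
    have : (q.2 : ℕ) + 1 < 2 ^ q.1 := by omega
    exact_mod_cast this
  have hle : ∀ q : DyadicIndex, (q.2 : ℝ) / 2 ^ q.1 ≤ ((q.2 : ℝ) + 1) / 2 ^ q.1 := fun q => by
    gcongr; linarith
  have hlo0 : ∀ q, 0 ≤ lo q := fun q => hc.inv_nonneg _ (by positivity) ((hle q).trans_lt (hlt1 q))
  have hlohi : ∀ q, lo q ≤ hi q := fun q => hc.inv_le_inv (by positivity) (hle q) (hlt1 q)
  have hmass : ∀ q, ∫ x in Ioc (lo q) (hi q), ‖g x‖ ^ r ≤ L * (2 : ℝ) ^ (-(q.1 : ℝ)) := by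
    intro q
    calc _ = ∫ x in Ioc (lo q) (hi q), ‖f x‖ ^ r := by
          refine integral_congr_ae ?_
          filter_upwards [hfgI (hlo0 q)] with x hx
          rw [hx]
      _ ≤ L * (G (hi q) - G (lo q)) := hfL _ _ (hlo0 q) (hlohi q)
      _ = _ := by
          simp only [hlo, hhi]
          rw [hc.apply_inv _ (by positivity) (hlt1 q),
            hc.apply_inv _ (by positivity) ((hle q).trans_lt (hlt1 q)), Real.rpow_neg (by norm_num),
            Real.rpow_natCast]
          congr 1
          field_simp
          ring
  set b : DyadicIndex → ℝ → ℂ := fun q => lowPart g (Ioc (lo q) (hi q)) (ht q) with hb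
  have hbm : ∀ q, StronglyMeasurable (b q) := fun q =>
    hgm.indicator (measurableSet_Ioc.inter (measurableSet_low hgm _))
  have hbb : ∀ q x, ‖b q x‖ ≤ ht q := fun q x => by
    simp only [hb, lowPart]
    by_cases hx : x ∈ Ioc (lo q) (hi q) ∩ {x | ‖g x‖ ≤ ht q}
    · rw [indicator_of_mem hx]; exact hx.2
    · rw [indicator_of_notMem hx, norm_zero]; exact (hht0 q).le
  have hbc : ∀ q, HasCompactSupport (b q) := fun q =>
    HasCompactSupport.intro (isCompact_Icc (a := lo q) (b := hi q)) fun x hx =>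
      indicator_of_notMem (fun h => hx (Ioc_subset_Icc_self h.1)) _
  have hgpq : ∀ q, IntegrableOn (fun x => ‖g x‖ ^ r) (Ioc (lo q) (hi q)) := fun q =>
    hgpi.mono_set (hsubI (hlo0 q))
  -- the low parts, in mean square
  set c : ℕ → ℝ := fun m => (2 : ℝ) ^ ((2 - r) / 8 * m) *
    (C * (((2 : ℝ) ^ (-(m : ℝ) / 4)) ^ (2 - r) * (L * (2 : ℝ) ^ (-(m : ℝ))))) with hcdef
  have hc0 : ∀ m, 0 ≤ c m := fun m => by positivity
  have hcs : Summable fun q : DyadicIndex => c q.1 := by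
    refine summable_dyadicIndex hc0 ?_
    have hρ : (2 : ℝ) ^ (-((2 - r) / 8)) < 1 :=
      Real.rpow_lt_one_of_one_lt_of_neg one_lt_two (by linarith)
    refine ((summable_geometric_of_lt_one (by positivity) hρ).mul_left (C * L)).congr fun m => ?_
    simp only [hcdef]
    have e : ((2 : ℝ) ^ (-((2 - r) / 8))) ^ m = (2 : ℝ) ^ m * ((2 : ℝ) ^ ((2 - r) / 8 * m) *
        (((2 : ℝ) ^ (-(m : ℝ) / 4)) ^ (2 - r) * (2 : ℝ) ^ (-(m : ℝ)))) := by
      rw [← Real.rpow_natCast, ← Real.rpow_natCast, ← Real.rpow_mul (by norm_num),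
        ← Real.rpow_mul (by norm_num), ← Real.rpow_add two_pos, ← Real.rpow_add two_pos,
        ← Real.rpow_add two_pos]
      congr 1; ring
    rw [e]; ring
  have hlow : ∀ q, ∫⁻ l in I, ENNReal.ofReal ((2 : ℝ) ^ ((2 - r) / 8 * q.1)) *
      ‖kernelOp k (b q) l‖ₑ ^ 2 ≤ ENNReal.ofReal (c q.1) := by
    intro q
    rw [lintegral_const_mul' _ _ ENNReal.ofReal_ne_top]
    simp only [hcdef]
    rw [ENNReal.ofReal_mul (by positivity)]
    gcongr
    exact hCK (b q) (hbm q).measurable ⟨_, hbb q⟩ (hbc q) _ (by positivity)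
      (lintegral_lowPart_sq_le (hht0 q) hr2 (hgpq q) (hmass q))
  have hmeas : ∀ q, AEMeasurable (fun l => ENNReal.ofReal ((2 : ℝ) ^ ((2 - r) / 8 * q.1)) *
      ‖kernelOp k (b q) l‖ₑ ^ 2) (volume.restrict I) := fun q =>
    ((hk.aestronglyMeasurable_kernelOp (hbm q)).enorm.pow_const 2).const_mul _
  have hfin : ∫⁻ l in I, ∑' q, ENNReal.ofReal ((2 : ℝ) ^ ((2 - r) / 8 * q.1)) *
      ‖kernelOp k (b q) l‖ₑ ^ 2 ≠ ⊤ := by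
    rw [lintegral_tsum hmeas]
    exact ne_top_of_le_ne_top hcs.tsum_ofReal_ne_top (ENNReal.tsum_le_tsum hlow)
  have hae := ae_lt_top' (AEMeasurable.tsum hmeas) hfin
  -- the high parts, uniformly
  set d : ℕ → ℝ := fun m => (2 : ℝ) ^ ((2 - r) / 8 * m) *
    (M * (((2 : ℝ) ^ (-(m : ℝ) / 4)) ^ (1 - r) * (L * (2 : ℝ) ^ (-(m : ℝ))))) ^ 2 with hd
  have hds : Summable fun q : DyadicIndex => d q.1 := by
    refine summable_dyadicIndex (fun m => by positivity) ?_
    have hρ : (2 : ℝ) ^ ((3 * r - 10) / 8) < 1 :=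
      Real.rpow_lt_one_of_one_lt_of_neg one_lt_two (by linarith)
    refine ((summable_geometric_of_lt_one (by positivity) hρ).mul_left ((M * L) ^ 2)).congr
      fun m => ?_
    simp only [hd]
    have e : ((2 : ℝ) ^ ((3 * r - 10) / 8)) ^ m = (2 : ℝ) ^ m * ((2 : ℝ) ^ ((2 - r) / 8 * m) *
        (((2 : ℝ) ^ (-(m : ℝ) / 4)) ^ (1 - r) * (2 : ℝ) ^ (-(m : ℝ))) ^ 2) := by
      rw [← Real.rpow_natCast, ← Real.rpow_natCast, ← Real.rpow_mul (by norm_num),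
        ← Real.rpow_mul (by norm_num), ← Real.rpow_add two_pos, ← Real.rpow_two,
        ← Real.rpow_mul (by norm_num), ← Real.rpow_add two_pos, ← Real.rpow_add two_pos]
      congr 1; ring
    rw [e]; ring
  filter_upwards [hae, hslice] with l hl hkl
  have hsum1 : Summable fun q : DyadicIndex => (2 : ℝ) ^ ((2 - r) / 8 * q.1) *
      ‖kernelOp k (b q) l‖ ^ 2 := by
    refine (ENNReal.summable_toReal hl.ne).congr fun q => ?_
    rw [ENNReal.toReal_mul, ENNReal.toReal_ofReal (by positivity), ENNReal.toReal_pow,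
      toReal_enorm]
  refine Summable.of_nonneg_of_le (fun q => by positivity) (fun q => ?_)
    ((hsum1.mul_left 2).add (hds.mul_left 2))
  have hhigh := norm_integral_sub_lowPart_le (κ := k l) (hlo0 q) (hht0 q) hr1 hM hgm hkl.1 hkl.2
    (memLp_integrableOn_Ioc hp1 hgLp (hlo0 q)) (hgpq q) (hmass q)
  have hfint : ∫ x in Ioc (lo q) (hi q), f x * k l x = ∫ x in Ioc (lo q) (hi q), g x * k l x := by
    refine integral_congr_ae ?_
    filter_upwards [hfgI (hlo0 q)] with x hx
    rw [hx]
  change _ * ‖∫ x in Ioc (lo q) (hi q), f x * k l x‖ ^ 2 ≤ _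
  rw [hfint]
  set T := ∫ x in Ioc (lo q) (hi q), g x * k l x
  change ‖T - kernelOp k (b q) l‖ ≤ _ at hhigh
  have h1 : ‖T‖ ≤ ‖kernelOp k (b q) l‖ + ‖T - kernelOp k (b q) l‖ := by
    have := norm_add_le (kernelOp k (b q) l) (T - kernelOp k (b q) l)
    rwa [add_sub_cancel] at this
  have h2 : ‖T‖ ^ 2 ≤ 2 * ‖kernelOp k (b q) l‖ ^ 2 + 2 * ‖T - kernelOp k (b q) l‖ ^ 2 := by
    have := pow_le_pow_left₀ (norm_nonneg _) h1 2
    nlinarith [sq_nonneg (‖kernelOp k (b q) l‖ - ‖T - kernelOp k (b q) l‖)]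
  calc _ ≤ (2 : ℝ) ^ ((2 - r) / 8 * q.1) *
        (2 * ‖kernelOp k (b q) l‖ ^ 2 + 2 * ‖T - kernelOp k (b q) l‖ ^ 2) := by gcongr
    _ ≤ (2 : ℝ) ^ ((2 - r) / 8 * q.1) * (2 * ‖kernelOp k (b q) l‖ ^ 2 +
        2 * (M * (ht q ^ (1 - r) * (L * (2 : ℝ) ^ (-(q.1 : ℝ))))) ^ 2) := by gcongr
    _ = _ := by simp only [hd, hht]; ring

/-! ### Truncations -/

/-- The restriction of `φ` to `(0, D)`. -/
def cutoff (φ : ℝ → ℂ) (D : ℝ) : ℝ → ℂ := (Ioo 0 D).indicator φ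

lemma integrable_cutoff {φ : ℝ → ℂ} (hφ : ∀ T, IntegrableOn φ (Ioc 0 T)) (D : ℝ) :
    Integrable (cutoff φ D) :=
  (integrable_indicator_iff measurableSet_Ioo).2 ((hφ D).mono_set Ioo_subset_Ioc_self)

lemma integral_cutoff (φ : ℝ → ℂ) {D s t : ℝ} (hs : 0 ≤ s) (hst : s ≤ t) :
    ∫ x in s..t, cutoff φ D x = ∫ x in (min s D)..(min t D), φ x := by
  rw [intervalIntegral.integral_of_le hst, intervalIntegral.integral_of_le
    (min_le_min_right D hst)]
  unfold cutoff
  rw [setIntegral_indicator measurableSet_Ioo]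
  have h1 : (Ioc s t ∩ Ioo 0 D : Set ℝ) =ᵐ[volume] (Ioc s t ∩ Ioc 0 D : Set ℝ) :=
    (ae_eq_refl _).inter Ioo_ae_eq_Ioc
  rw [setIntegral_congr_set h1]
  congr 2
  ext x
  simp only [mem_inter_iff, mem_Ioc, min_lt_iff, le_min_iff]
  constructor
  · rintro ⟨⟨h1, h2⟩, -, h3⟩
    exact ⟨Or.inl h1, h2, h3⟩
  · rintro ⟨h1, h2, h3⟩
    have h4 : s < x := h1.resolve_right (not_lt.2 h3)
    exact ⟨⟨h4, h2⟩, hs.trans_lt h4, h3⟩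

section cutoffEstimates

variable {ω : ℝ → ℝ → ℝ} {W β K : ℝ} {φ : ℝ → ℂ}

lemma norm_integral_cutoff_le (hω : IsControl ω W) (hβ : 0 ≤ β) (hK : 0 ≤ K)
    (hφω : ∀ s t, 0 ≤ s → s ≤ t → ‖∫ x in s..t, φ x‖ ≤ K * ω s t ^ β) {D s t : ℝ} (hD : 0 ≤ D)
    (hs : 0 ≤ s) (hst : s ≤ t) : ‖∫ x in s..t, cutoff φ D x‖ ≤ K * ω s t ^ β := by
  rw [integral_cutoff φ hs hst]
  have h0 : 0 ≤ min s D := le_min hs hD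
  have h1 : min s D ≤ min t D := min_le_min_right D hst
  rcases le_total s D with h | h
  · refine (hφω _ _ h0 h1).trans ?_
    have h2 := hω.nonneg _ _ h0 h1
    rw [min_eq_left h] at *
    gcongr
    exact hω.mono hs le_rfl h1 (min_le_left _ _)
  · rw [min_eq_right h, min_eq_right (h.trans hst), intervalIntegral.integral_same, norm_zero]
    have := Real.rpow_nonneg (hω.nonneg s t hs hst) β
    positivity

/-- Two cutoffs beyond `N` differ by a function whose primitive is small, since `ω` is small
beyond `N`. -/
lemma norm_integral_cutoff_sub_le_tail (hω : IsControl ω W) (hβ : 0 ≤ β) (hK : 0 ≤ K)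
    (hφ : ∀ T, IntegrableOn φ (Ioc 0 T))
    (hφω : ∀ s t, 0 ≤ s → s ≤ t → ‖∫ x in s..t, φ x‖ ≤ K * ω s t ^ β) {N η : ℝ} (hN0 : 0 ≤ N)
    (hη : 0 < η) (hN : ∀ s t, N ≤ s → s ≤ t → ω s t < η) {D D' : ℝ} (hD : N ≤ D) (hD' : N ≤ D')
    {s t : ℝ} (hs : 0 ≤ s) (hst : s ≤ t) :
    ‖∫ x in s..t, (cutoff φ D x - cutoff φ D' x)‖ ≤ 2 * K * η ^ β := by
  have hii : ∀ u v, 0 ≤ u → 0 ≤ v → IntervalIntegrable φ volume u v := by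
    have : ∀ u v, 0 ≤ u → u ≤ v → IntervalIntegrable φ volume u v := fun u v hu huv =>
      (intervalIntegrable_iff_integrableOn_Ioc_of_le huv).2
        ((hφ v).mono_set (Ioc_subset_Ioc_left hu))
    intro u v hu hv
    rcases le_total u v with h | h
    · exact this u v hu h
    · exact (this v u hv h).symm
  have hD0 := hN0.trans hD
  have hD0' := hN0.trans hD'
  have hstep : ∀ u, 0 ≤ u → ‖∫ x in (min u D')..(min u D), φ x‖ ≤ K * η ^ β := by
    have hfar : ∀ v v', N ≤ v → v ≤ v' → ‖∫ x in v..v', φ x‖ ≤ K * η ^ β := fun v v' hv hv' => by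
      refine (hφω v v' (hN0.trans hv) hv').trans ?_
      have := hω.nonneg v v' (hN0.trans hv) hv'
      have := (hN v v' hv hv').le
      gcongr
    intro u hu
    have hnn : 0 ≤ K * η ^ β := by positivity
    rcases le_total u D with h1 | h1 <;> rcases le_total u D' with h2 | h2
    · rw [min_eq_left h1, min_eq_left h2, intervalIntegral.integral_same, norm_zero]; exact hnn
    · rw [min_eq_left h1, min_eq_right h2]; exact hfar _ _ hD' h2
    · rw [min_eq_right h1, min_eq_left h2, intervalIntegral.integral_symm, norm_neg]
      exact hfar _ _ hD h1
    · rw [min_eq_right h1, min_eq_right h2]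
      rcases le_total D' D with h | h
      · exact hfar _ _ hD' h
      · rw [intervalIntegral.integral_symm, norm_neg]; exact hfar _ _ hD h
  have ht := hs.trans hst
  have m1 := le_min hs hD0
  have m2 := le_min hs hD0'
  have m3 := le_min ht hD0
  have m4 := le_min ht hD0'
  have e : ∫ x in s..t, (cutoff φ D x - cutoff φ D' x) =
      (∫ x in (min t D')..(min t D), φ x) - ∫ x in (min s D')..(min s D), φ x := by
    rw [intervalIntegral.integral_sub (integrable_cutoff hφ D).intervalIntegrable
      (integrable_cutoff hφ D').intervalIntegrable, integral_cutoff φ hs hst,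
      integral_cutoff φ hs hst]
    have a1 := intervalIntegral.integral_add_adjacent_intervals (hii _ _ m2 m1) (hii _ _ m1 m3)
    have a2 := intervalIntegral.integral_add_adjacent_intervals (hii _ _ m2 m4) (hii _ _ m4 m3)
    linear_combination a1 - a2
  rw [e]
  calc _ ≤ K * η ^ β + K * η ^ β := (norm_sub_le _ _).trans (add_le_add (hstep t ht) (hstep s hs))
    _ = _ := by ring

/-- Interpolation between the previous bound and the modulus of continuity: a smaller exponent is
kept, and a power of the tail is gained. -/
lemma norm_integral_cutoff_sub_le (hω : IsControl ω W) {β' : ℝ} (hβ' : 0 ≤ β') (hββ : β' ≤ β)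
    (hK : 0 ≤ K) (hφ : ∀ T, IntegrableOn φ (Ioc 0 T))
    (hφω : ∀ s t, 0 ≤ s → s ≤ t → ‖∫ x in s..t, φ x‖ ≤ K * ω s t ^ β) {N η : ℝ} (hN0 : 0 ≤ N)
    (hη : 0 < η) (hN : ∀ s t, N ≤ s → s ≤ t → ω s t < η) {D D' : ℝ} (hD : N ≤ D) (hD' : N ≤ D')
    {s t : ℝ} (hs : 0 ≤ s) (hst : s ≤ t) :
    ‖∫ x in s..t, (cutoff φ D x - cutoff φ D' x)‖ ≤ 2 * K * η ^ (β - β') * ω s t ^ β' := by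
  have hβ := hβ'.trans hββ
  have h0 := hω.nonneg s t hs hst
  rw [mul_assoc]
  rcases le_total (ω s t) η with h | h
  · have h1 : ‖∫ x in s..t, (cutoff φ D x - cutoff φ D' x)‖ ≤ 2 * K * ω s t ^ β := by
      rw [intervalIntegral.integral_sub (integrable_cutoff hφ D).intervalIntegrable
        (integrable_cutoff hφ D').intervalIntegrable]
      refine (norm_sub_le _ _).trans ((add_le_add
        (norm_integral_cutoff_le hω hβ hK hφω (hN0.trans hD) hs hst)
        (norm_integral_cutoff_le hω hβ hK hφω (hN0.trans hD') hs hst)).trans (le_of_eq ?_))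
      ring
    refine h1.trans ?_
    have e : ω s t ^ β = ω s t ^ (β - β') * ω s t ^ β' := by
      rw [← Real.rpow_add_of_nonneg h0 (sub_nonneg.2 hββ) hβ', sub_add_cancel]
    rw [e]
    have : 0 ≤ β - β' := sub_nonneg.2 hββ
    gcongr
  · refine (norm_integral_cutoff_sub_le_tail hω hβ hK hφ hφω hN0 hη hN hD hD' hs hst).trans ?_
    have e : η ^ β = η ^ (β - β') * η ^ β' := by
      rw [← Real.rpow_add hη, sub_add_cancel]
    rw [e]
    gcongr

end cutoffEstimates

/-! ### Convergence at a point -/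

/-- The deterministic convergence statement: if the primitives of the `φ_i` have a common modulus
`ω ^ β` with `β > 1 / 2`, the truncated multilinear integrals form a Cauchy net. -/
lemma cauchySeq_integral_cutoff {n : ℕ} (A : Finset (Fin n × Fin n)) {ω : ℝ → ℝ → ℝ} {W β K : ℝ}
    (hω : IsControl ω W) (hβ : 1 / 2 < β) (hK : 0 ≤ K) {φ : Fin n → ℝ → ℂ}
    (hφ : ∀ i T, IntegrableOn (φ i) (Ioc 0 T))
    (hφω : ∀ i s t, 0 ≤ s → s ≤ t → ‖∫ x in s..t, φ i x‖ ≤ K * ω s t ^ β) :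
    CauchySeq fun D : Fin n → ℝ => ∫ x : Fin n → ℝ,
      (∏ i, cutoff (φ i) (D i) (x i)) * ∏ a ∈ A, chiPos (x a.1 - x a.2) := by
  obtain ⟨β', hβ'1, hβ'2⟩ := exists_between hβ
  have hβ'0 : 0 ≤ β' := by linarith
  have hγ : 0 < β - β' := by linarith
  have hW := hω.bound_nonneg
  obtain ⟨C, hC, hCψ⟩ := hasModulus_iteratedIntegral hω hβ'1 (b := K * W ^ (β - β'))
    (by positivity) n
  set Q : ℝ := (∑ σ : Equiv.Perm (Fin n), ‖orderCoeff A σ‖) * (C * (2 * K)) with hQ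
  have hS0 : 0 ≤ ∑ σ : Equiv.Perm (Fin n), ‖orderCoeff A σ‖ :=
    Finset.sum_nonneg fun _ _ => norm_nonneg _
  have hQ0 : 0 ≤ Q := by positivity
  refine Metric.cauchySeq_iff'.2 fun δ hδ => ?_
  set η : ℝ := (δ / (Q + 1)) ^ (1 / (β - β')) with hηdef
  have hη : 0 < η := by positivity
  have hηγ : η ^ (β - β') = δ / (Q + 1) := by
    rw [hηdef, ← Real.rpow_mul (by positivity), one_div_mul_cancel hγ.ne', Real.rpow_one]
  obtain ⟨N, hN0, hN⟩ := hω.exists_tail_lt hη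
  refine ⟨fun _ => N, fun D hD => ?_⟩
  have hmod : ∀ D : Fin n → ℝ, (∀ i, N ≤ D i) → ∀ i s t, 0 ≤ s → s ≤ t →
      ‖∫ x in s..t, cutoff (φ i) (D i) x‖ ≤ K * W ^ (β - β') * ω s t ^ β' := by
    intro D hD i s t hs hst
    have h0 := hω.nonneg s t hs hst
    refine (norm_integral_cutoff_le hω (by linarith) hK (hφω i) (hN0.trans (hD i)) hs hst).trans ?_
    have e : ω s t ^ β = ω s t ^ (β - β') * ω s t ^ β' := by
      rw [← Real.rpow_add_of_nonneg h0 hγ.le hβ'0, sub_add_cancel]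
    rw [e, mul_assoc]
    have := hω.le_bound s t hs hst
    gcongr
  obtain ⟨t, hND, hDt⟩ : ∃ t, N ≤ t ∧ ∀ i, D i ≤ t := by
    obtain ⟨B, hB⟩ := (Set.finite_range D).bddAbove
    exact ⟨max N B, le_max_left _ _, fun i => (hB ⟨i, rfl⟩).trans (le_max_right _ _)⟩
  have ht0 := hN0.trans hND
  have hformula : ∀ D : Fin n → ℝ, (∀ i, D i ≤ t) → ∫ x : Fin n → ℝ,
      (∏ i, cutoff (φ i) (D i) (x i)) * ∏ a ∈ A, chiPos (x a.1 - x a.2) =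
      ∑ σ : Equiv.Perm (Fin n), orderCoeff A σ *
        iteratedIntegral n (fun i => cutoff (φ (σ i)) (D (σ i))) t := fun D hD =>
    integral_prod_chiPos A (fun i => integrable_cutoff (hφ i) (D i)) ht0
      (fun i x hx => indicator_of_notMem (fun h => absurd h.1 (not_lt.2 hx)) _)
      (fun i x hx => indicator_of_notMem (fun h => absurd h.2 (not_lt.2 ((hD i).trans hx))) _)
  rw [dist_eq_norm, hformula D hDt, hformula (fun _ => N) (fun _ => hND), ← Finset.sum_sub_distrib]
  calc _ ≤ ∑ σ : Equiv.Perm (Fin n), ‖orderCoeff A σ‖ * (C * (2 * K * η ^ (β - β'))) := by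
        refine norm_sum_le_of_le _ fun σ _ => ?_
        rw [← mul_sub, norm_mul]
        gcongr
        exact (hCψ (fun i => cutoff (φ (σ i)) (D (σ i))) (fun i => cutoff (φ (σ i)) N)
          (2 * K * η ^ (β - β')) (by positivity) (fun i => integrable_cutoff (hφ _) _)
          (fun i => integrable_cutoff (hφ _) _) (fun i => hmod D hD _)
          (fun i => hmod (fun _ => N) (fun _ => le_rfl) _)
          (fun i s t hs hst => norm_integral_cutoff_sub_le hω hβ'0 hβ'2.le hK (hφ _) (hφω _) hN0 hη
            hN (hD _) le_rfl hs hst)).2.1 t ht0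
    _ = Q * (δ / (Q + 1)) := by rw [← Finset.sum_mul, hηγ, hQ]; ring
    _ < δ := by
        rw [mul_div_assoc', div_lt_iff₀ (by positivity)]
        nlinarith

lemma measurable_prod_chiPos {n : ℕ} (A : Finset (Fin n × Fin n)) :
    Measurable fun x : Fin n → ℝ => ∏ a ∈ A, chiPos (x a.1 - x a.2) := by
  have h : Measurable chiPos := measurable_const.indicator measurableSet_Ioi
  exact Finset.measurable_prod _ fun a _ =>
    h.comp ((measurable_pi_apply a.1).sub (measurable_pi_apply a.2))

lemma norm_chiPos_le_one (t : ℝ) : ‖chiPos t‖ ≤ 1 := by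
  unfold chiPos
  by_cases h : t ∈ Ioi (0 : ℝ)
  · rw [indicator_of_mem h, norm_one]
  · rw [indicator_of_notMem h, norm_zero]; exact zero_le_one

lemma indicator_orthant_integrand {n : ℕ} (A : Finset (Fin n × Fin n)) (k : Fin n → ℝ → ℝ → ℂ)
    (f : Fin n → ℝ → ℂ) (l : ℝ) (D : Fin n → ℝ) :
    (orthant n).indicator (integrand A (truncKernel k D) f l) =
      fun x => (∏ i, cutoff (fun x => f i x * k i l x) (D i) (x i)) *
        ∏ a ∈ A, chiPos (x a.1 - x a.2) := by
  ext x
  by_cases hx : x ∈ orthant n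
  · rw [indicator_of_mem hx]
    unfold integrand
    congr 1
    refine Finset.prod_congr rfl fun i _ => ?_
    have hi : 0 < x i := hx i (mem_univ i)
    by_cases hD : x i < D i
    · simp [cutoff, truncKernel, chiPos, hi, hD]
    · simp [cutoff, truncKernel, chiPos, hD]
  · rw [indicator_of_notMem hx]
    have : ∃ i, ¬ 0 < x i := by
      by_contra! hcon
      exact hx fun i _ => hcon i
    obtain ⟨i, hi⟩ := this
    rw [Finset.prod_eq_zero (Finset.mem_univ i), zero_mul]
    exact indicator_of_notMem (fun h => hi h.1) _

lemma measurableSet_orthant (n : ℕ) : MeasurableSet (orthant n) :=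
  MeasurableSet.univ_pi fun _ => measurableSet_Ioi

/-- The absolute convergence of the truncated integrals needs local integrability only; the modulus
yields the limit. -/
lemma convergesAt_of_control {n : ℕ} (A : Finset (Fin n × Fin n)) {k : Fin n → ℝ → ℝ → ℂ}
    {f : Fin n → ℝ → ℂ} {l : ℝ} {ω : ℝ → ℝ → ℝ} {W β K : ℝ}
    (hω : IsControl ω W) (hβ : 1 / 2 < β) (hK : 0 ≤ K)
    (hφ : ∀ i T, IntegrableOn (fun x => f i x * k i l x) (Ioc 0 T))
    (hφω : ∀ i s t, 0 ≤ s → s ≤ t → ‖∫ x in s..t, f i x * k i l x‖ ≤ K * ω s t ^ β) :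
    ConvergesAt A k f l := by
  refine ⟨fun D => ?_, ?_⟩
  · rw [← integrable_indicator_iff (measurableSet_orthant n), indicator_orthant_integrand]
    refine (Integrable.fintype_prod fun i => integrable_cutoff (hφ i) (D i)).mul_bdd (c := 1)
      (measurable_prod_chiPos A).aestronglyMeasurable (ae_of_all _ fun x => ?_)
    rw [norm_prod]
    exact Finset.prod_le_one (fun _ _ => norm_nonneg _) fun a _ => norm_chiPos_le_one _
  · obtain ⟨T, hT⟩ := cauchySeq_tendsto_of_complete (cauchySeq_integral_cutoff A hω hβ hK hφ hφω)
    refine ⟨T, fun δ hδ => ?_⟩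
    obtain ⟨N, hN⟩ := Metric.tendsto_atTop.1 hT δ hδ
    obtain ⟨B, hB⟩ := (Set.finite_range N).bddAbove
    refine ⟨B, fun D hD => ?_⟩
    have := hN D fun i => (hB ⟨i, rfl⟩).trans (hD i)
    rw [transform, ← integral_indicator (measurableSet_orthant n), indicator_orthant_integrand,
      ← dist_eq_norm, dist_comm]
    exact this

end MultilinearTransform

end

theorem theorem5p3 (n : ℕ) (hn : 2 ≤ n) (A : Finset (Fin n × Fin n))
    (I : Set ℝ) (hI : NullMeasurableSet I volume)
    (k : Fin n → ℝ → ℝ → ℂ)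
    (hk : ∀ i, MultilinearTransform.IsBoundedKernel I (k i))
    (hK : ∀ i, MultilinearTransform.SatisfiesL2Bound I (k i))
    (p : ENNReal) (hp1 : 1 ≤ p) (hp2 : p < 2)
    (f : Fin n → ℝ → ℂ) (hf : ∀ i, MemLp (f i) p (volume.restrict (Ioi (0 : ℝ)))) :
    ∀ᵐ l ∂(volume.restrict I), MultilinearTransform.ConvergesAt A k f l := by
  open MultilinearTransform in
  have hptop : p ≠ ⊤ := (hp2.trans (by simp)).ne
  have hfi : ∀ i, IntegrableOn (fun x => ‖f i x‖ ^ p.toReal) (Ioi 0) := fun i =>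
    (hf i).integrable_norm_rpow (zero_lt_one.trans_le hp1).ne' hptop
  have hr2 : p.toReal < 2 := by
    have := (ENNReal.toReal_lt_toReal hptop (by simp)).2 hp2; simpa using this
  -- one clock for all the functions, since the control has to be common to all the `φ_i`
  obtain ⟨G, H, L, hc, hL, hFL⟩ := exists_clock (F := fun x => ∑ i, ‖f i x‖ ^ p.toReal)
    (fun x _ => Finset.sum_nonneg fun i _ => by positivity)
    (integrable_finsetSum _ fun i _ => hfi i)
  have hfL : ∀ i s t, 0 ≤ s → s ≤ t →
      ∫ x in Ioc s t, ‖f i x‖ ^ p.toReal ≤ L * (G t - G s) := by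
    intro i s t hs hst
    have hsub : Ioc s t ⊆ Ioi 0 := fun x hx => hs.trans_lt hx.1
    refine le_trans (setIntegral_mono ((hfi i).mono_set hsub)
      (IntegrableOn.mono_set (integrable_finsetSum _ fun i _ => hfi i) hsub) fun x => ?_)
      (hFL s t hs hst)
    exact Finset.single_le_sum (f := fun i => ‖f i x‖ ^ p.toReal) (fun i _ => by positivity)
      (Finset.mem_univ i)
  have hsum := ae_all_iff.2 fun i =>
    ae_summable_dyadic hI (hk i) (hK i) hp1 hp2 (hf i) hc hL (hfL i)
  have hslice : ∀ᵐ l ∂(volume.restrict I), ∀ i, ∃ M : ℝ,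
      AEStronglyMeasurable (k i l) (volume.restrict (Ioi (0 : ℝ))) ∧
        ∀ x, 0 < x → ‖k i l x‖ ≤ M := by
    refine ae_all_iff.2 fun i => ?_
    obtain ⟨M, -, hM⟩ := (hk i).ae_slice hI
    filter_upwards [hM] with l hl using ⟨M, hl⟩
  filter_upwards [hsum, hslice] with l hl hkl
  have hφ : ∀ i T, IntegrableOn (fun x => f i x * k i l x) (Ioc 0 T) := by
    intro i T
    obtain ⟨M, h1, h2⟩ := hkl i
    refine (memLp_integrableOn_Ioc hp1 (hf i) le_rfl).mul_bdd (c := M)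
      (h1.mono_measure (Measure.restrict_mono Ioc_subset_Ioi_self le_rfl)) ?_
    filter_upwards [ae_restrict_mem measurableSet_Ioc] with x hx using h2 x hx.1
  obtain ⟨ω, W, β, K, hω, hβ, hK0, hbd⟩ := exists_control hc hφ (by linarith) hl
  exact convergesAt_of_control A hω hβ hK0 hφ hbd
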